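/- Let $n\ge 1$, let $X\subset\mathbb R^n$ be compact, let $f:X\to X$ be continuous, and let $\sigma>0$ be such that $f(x)+w\in X$ for all $x\in X$ and $w\in[-\sigma,\sigma]^n$. Let $\Omega=([-\sigma,\sigma]^n)^{\mathbb N}$ carry the law $\mathbb P$ of an i.i.d. sequence of uniformly distributed points of $[-\sigma,\sigma]^n$, and put $f_\omega(x)=f(x)+\omega_0$ for $\omega=(\omega_i)_{i\ge0}\in\Omega$. Let $\mathcal C\subset X$ be the critical set, i.e. the set of points where the derivative $df$ of $f$ (taken within $X$) does not exist, is not uniquely determined, or is not invertible. Assume that $df$ is locally Hölder continuous on $X\setminus\mathcal C$ with some exponent $\alpha>0$, and that: (H1) $\mathcal C$ is contained in a finite union of images of $C^1$ maps $[0,1]^{n-1}\to\mathbb R^n$, and there are constants $B>1$, $\beta>0$ such that (these bounds being void if $\mathcal C=\emptyset$) - $\frac1B\,\mathrm{dist}(x,\mathcal C)^{\beta}\|v\|\le\|df(x)v\|\le B\,\mathrm{dist}(x,\mathcal C)^{-\beta}\|v\|$ for all $x\in X\setminus\mathcal C$ and $v\in\mathbb R^n$; - for all $x,y\in X\setminus\mathcal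 C$ with $|x-y|\le\mathrm{dist}(x,\mathcal C)/2$, both $\bigl|\log\|df(x)^{-1}\|-\log\|df(y)^{-1}\|\bigr|$ and $\bigl|\log|\det df(x)|-\log|\det df(y)|\bigr|$ are at most $B\,\mathrm{dist}(x,\mathcal C)^{-\beta}|x-y|$. (In case $\mathrm{dist}(x,\mathcal C)=0$, $\mathrm{dist}(x,\mathcal C)^{-\beta}$ is read as $+\infty$.) (H2) $Y\subset X$ is a nonempty compact set with $f(x)+w\in Y$ for all $x\in Y$, $w\in[-\sigma,\sigma]^n$, the Markov process on $Y$ with transition kernel $\mathcal P_x(A)=\mathbb P(f_\omega(x)\in A)$ is uniquely ergodic, i.e. has exactly one stationary probability measure $\mu$, and, with $g(x)=\log\|df(x)^{-1}\|$, $$\lambda=\int_Y g\,d\mu<0 .$$ Then for all sufficiently small $\theta>0$ the formula $$P_\theta h(x)=\mathbb E\bigl[(e^{\theta g}h)\circ f_\omega(x)\bigr],\qquad h\in C^0(Y),\ x\in Y,$$ has absolutely convergent expectations and defines a bounded operator $P_\theta$ on the space $C^0(Y)$ of complex-valued continuous functions; its spectral radius $\lambda_\theta$ is an eigenvalue of $P_\theta$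 (the leading eigenvalue); and, as $\theta\to0^+$, $$\lambda_\theta=1+\theta\lambda+O(\theta^{4/3})\qquad\text{and}\qquad \lambda_\theta=e^{\theta\lambda}+O(\theta^{4/3}).$$ -/

import Mathlib

open MeasureTheory Set Filter Topology Asymptotics

noncomputable section

namespace RandomHorseshoe

/-- The cube `[-σ, σ]^n`, as a subset of Euclidean space. -/
def cube (n : ℕ) (σ : ℝ) : Set (EuclideanSpace ℝ (Fin n)) :=
  {w | ∀ i, w i ∈ Icc (-σ) σ}

/-- The uniform probability measure on the cube `[-σ, σ]^n`:
normalized Lebesgue measure, i.e. the `n`-fold product of `Leb / (2σ)` on `[-σ, σ]`. -/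
def noise (n : ℕ) (σ : ℝ) : Measure (cube n σ) :=
  (volume (cube n σ))⁻¹ • (volume : Measure (EuclideanSpace ℝ (Fin n))).comap Subtype.val

theorem cube_eq_preimage (n : ℕ) (σ : ℝ) :
    cube n σ = (WithLp.ofLp : EuclideanSpace ℝ (Fin n) → (Fin n → ℝ)) ⁻¹'
      (Set.pi univ fun _ => Icc (-σ) σ) := by
  ext w
  simp only [cube, mem_ofPred_eq, mem_preimage, mem_univ_pi]

theorem measurableSet_cube (n : ℕ) (σ : ℝ) : MeasurableSet (cube n σ) := by
  rw [cube_eq_preimage]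
  exact (MeasurableSet.univ_pi fun _ => measurableSet_Icc).preimage
    (PiLp.volume_preserving_ofLp (Fin n)).measurable

theorem volume_cube (n : ℕ) (σ : ℝ) : volume (cube n σ) = ENNReal.ofReal (2 * σ) ^ n := by
  rw [cube_eq_preimage, (PiLp.volume_preserving_ofLp (Fin n)).measure_preimage
    (MeasurableSet.univ_pi fun _ => measurableSet_Icc).nullMeasurableSet, volume_pi_pi]
  simp [Real.volume_Icc, two_mul]

theorem isProbabilityMeasure_noise (n : ℕ) {σ : ℝ} (hσ : 0 < σ) :
    IsProbabilityMeasure (noise n σ) := by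
  constructor
  have h : (volume : Measure (EuclideanSpace ℝ (Fin n))).comap
      (Subtype.val : cube n σ → _) univ = volume (cube n σ) := by
    rw [comap_subtype_coe_apply (measurableSet_cube n σ)]
    simp
  rw [noise, Measure.smul_apply, h, smul_eq_mul, volume_cube]
  refine ENNReal.inv_mul_cancel (pow_ne_zero _ ?_) (ENNReal.pow_ne_top ENNReal.ofReal_ne_top)
  simpa using hσ

/-- A continuous map `f` of a compact set `X ⊆ ℝⁿ`, together with an amplitude `σ > 0` of
additive noise which keeps `X` invariant. (Only the values of `f` on `X` matter.) -/
structure NoisyMap (n : ℕ) where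
  X : Set (EuclideanSpace ℝ (Fin n))
  isCompact_X : IsCompact X
  f : EuclideanSpace ℝ (Fin n) → EuclideanSpace ℝ (Fin n)
  continuousOn_f : ContinuousOn f X
  σ : ℝ
  σ_pos : 0 < σ
  add_mem : ∀ x ∈ X, ∀ w ∈ cube n σ, f x + w ∈ X

namespace NoisyMap

variable {n : ℕ} (S : NoisyMap n)

/-- The space of noise realizations `Ω = ([-σ,σ]^n)^ℕ`. -/
abbrev Ω : Type := ℕ → cube n S.σ

instance : IsProbabilityMeasure (noise n S.σ) := isProbabilityMeasure_noise n S.σ_pos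

/-- The i.i.d. uniform law `ℙ` on `Ω`. -/
def ℙ : Measure S.Ω := Measure.infinitePi fun _ => noise n S.σ

/-- The derivative of `f : X → X`, taken within `X`. -/
def df (x : EuclideanSpace ℝ (Fin n)) :
    EuclideanSpace ℝ (Fin n) →L[ℝ] EuclideanSpace ℝ (Fin n) :=
  fderivWithin ℝ S.f S.X x

/-- The inverse of the derivative; meaningful off the critical set. -/
def dfInv (x : EuclideanSpace ℝ (Fin n)) :
    EuclideanSpace ℝ (Fin n) →L[ℝ] EuclideanSpace ℝ (Fin n) :=
  (S.df x).inverse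

/-- The critical set `𝒞`: the points of `X` where the (uniquely determined) derivative of
`f : X → X` does not exist or is not invertible. -/
def crit : Set (EuclideanSpace ℝ (Fin n)) :=
  {x ∈ S.X | ¬ (UniqueDiffWithinAt ℝ S.X x ∧ DifferentiableWithinAt ℝ S.f S.X x ∧
    (S.df x).IsInvertible)}

/-- The observable `g(x) = log ‖df(x)⁻¹‖`. -/
def g (x : EuclideanSpace ℝ (Fin n)) : ℝ := Real.log ‖S.dfInv x‖

/-- `f` is of class `C^{1+α}` off the critical set, for some `α > 0`: the derivative is
locally `α`-Hölder on `X \ 𝒞`. -/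
def IsC1Holder : Prop :=
  ∃ α : ℝ, 0 < α ∧ ∀ x ∈ S.X \ S.crit, ∃ K r : ℝ, 0 < r ∧
    ∀ y ∈ S.X \ S.crit, ∀ z ∈ S.X \ S.crit, dist y x < r → dist z x < r →
      ‖S.df y - S.df z‖ ≤ K * dist y z ^ α

/-- Non-degeneracy of the critical set. The bounds by negative powers of `dist(x, 𝒞)` are
written after multiplication by `dist(x, 𝒞)^β`, so that they say nothing where
`dist(x, 𝒞) = 0`; as `Metric.infDist x ∅ = 0`, they are void if `𝒞` is empty. -/
structure NondegenerateCrit : Prop where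
  /-- `𝒞` lies in a finite union of `C¹`-parametrized hypersurface pieces. -/
  exists_param : ∃ (N : ℕ) (φ : Fin N → (Fin (n - 1) → ℝ) → EuclideanSpace ℝ (Fin n)),
    (∀ i, ContDiffOn ℝ 1 (φ i) (Icc 0 1)) ∧ S.crit ⊆ ⋃ i, φ i '' Icc 0 1
  exists_bounds : ∃ B β : ℝ, 1 < B ∧ 0 < β ∧
    (∀ x ∈ S.X \ S.crit, ∀ v : EuclideanSpace ℝ (Fin n),
      1 / B * Metric.infDist x S.crit ^ β * ‖v‖ ≤ ‖S.df x v‖ ∧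
      Metric.infDist x S.crit ^ β * ‖S.df x v‖ ≤ B * ‖v‖) ∧
    (∀ x ∈ S.X \ S.crit, ∀ y ∈ S.X \ S.crit, dist x y ≤ Metric.infDist x S.crit / 2 →
      Metric.infDist x S.crit ^ β * |Real.log ‖S.dfInv x‖ - Real.log ‖S.dfInv y‖|
        ≤ B * dist x y ∧
      Metric.infDist x S.crit ^ β * |Real.log (abs (S.df x).det) - Real.log (abs (S.df y).det)|
        ≤ B * dist x y)

/-- A nonempty compact subset `Y ⊆ X` that is invariant under all the maps `x ↦ f(x) + w`. -/
structure Component where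
  Y : Set (EuclideanSpace ℝ (Fin n))
  subset_X : Y ⊆ S.X
  isCompact_Y : IsCompact Y
  nonempty_Y : Y.Nonempty
  add_mem : ∀ x ∈ Y, ∀ w ∈ cube n S.σ, S.f x + w ∈ Y

namespace Component

variable {S} (C : S.Component)

instance : CompactSpace C.Y := isCompact_iff_compactSpace.mp C.isCompact_Y

/-- The random map `f_ω(x) = f(x) + ω₀`, restricted to `Y`. -/
def step (ω : S.Ω) (x : C.Y) : C.Y :=
  ⟨S.f x + (ω 0 : EuclideanSpace ℝ (Fin n)), C.add_mem x x.2 _ (ω 0).2⟩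

/-- `μ` is a stationary measure of the Markov process on `Y` with transition kernel
`𝒫_x(A) = ℙ(f_ω(x) ∈ A)`. -/
def IsStationary (μ : Measure C.Y) : Prop :=
  ∀ A : Set C.Y, MeasurableSet A → μ A = ∫⁻ x, S.ℙ {ω | C.step ω x ∈ A} ∂μ

/-- The process on `Y` is uniquely ergodic: `μ` is its only stationary probability measure. -/
structure IsUniquelyErgodic (μ : Measure C.Y) : Prop where
  isProbabilityMeasure : IsProbabilityMeasure μ
  isStationary : C.IsStationary μ
  unique : ∀ μ' : Measure C.Y, IsProbabilityMeasure μ' → C.IsStationary μ' → μ' = μ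

/-- `λ = ∫_Y log ‖df(x)⁻¹‖ dμ(x)`. -/
def exponent (μ : Measure C.Y) : ℝ := ∫ x : C.Y, S.g x ∂μ

/-- `T` is the twisted transfer operator `P_θ` on `C⁰(Y)`, i.e.
`(P_θ h)(x) = 𝔼[(e^{θ g} h) ∘ f_ω(x)]`, the expectations being absolutely convergent. -/
structure IsTwistedTransferOperator (θ : ℝ) (T : C(C.Y, ℂ) →L[ℂ] C(C.Y, ℂ)) : Prop where
  integrable : ∀ x : C.Y, Integrable (fun ω => Real.exp (θ * S.g (C.step ω x))) S.ℙ
  apply_eq : ∀ (h : C(C.Y, ℂ)) (x : C.Y),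
    T h x = ∫ ω, (Real.exp (θ * S.g (C.step ω x)) : ℂ) * h (C.step ω x) ∂S.ℙ

end Component

end NoisyMap

/-- `r` is the leading eigenvalue of `T`: an eigenvalue equal to the spectral radius. -/
structure IsLeadingEigenvalue {V : Type*} [NormedAddCommGroup V] [NormedSpace ℂ V]
    (T : V →L[ℂ] V) (r : ℝ) : Prop where
  hasEigenvalue : Module.End.HasEigenvalue (T : V →ₗ[ℂ] V) (r : ℂ)
  spectralRadius_eq : spectralRadius ℂ T = ENNReal.ofReal r
  nonneg : 0 ≤ r

end RandomHorseshoe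

end

/-! The noise has a bounded density. The law of `f_ω(x)` is normalized Lebesgue measure `ν`
restricted to the translated cube `W x`, so `P_θ h (x) = ∫_{W x} e^{θg} h dν`. Since `W x` varies
continuously up to null sets, this is a compact operator on continuous functions as soon as `e^{θg}`
is integrable.

Integrability comes from (H1). There `|g| ≤ log (B / dist^β)`, and the `r`-neighbourhood of finitely
many hypersurface pieces has volume `O(r)`. Hence `dist^{-1/2}`, and with it `e^{|g|/(2β)}`, is
integrable. It follows that `‖P_θ - P_0‖ = O(θ)`.

Unique ergodicity forces continuous harmonic functions to be constant, so `1` is a simple eigenvalue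
of `P_0`, with right eigenvector `1` and left eigenvector `μ`. It persists as a real eigenpair `(z,
h)` of `P_θ` with `h = 1 + O(θ)` and `∫ h dμ = 1`. For small `θ` the function `h` is positive, and
domination by `h` identifies `z` with the spectral radius. No information on the other eigenvalues
of `P_0` on the unit circle is needed.

Integrating the eigenvalue equation against the stationary `μ` gives `z = ∫ e^{θg} h dμ`. Expanding
both factors gives `z = 1 + θλ + O(θ²)`, which is stronger than the exponent `4/3`. The main steps
are `exists_eigenpair_of_near`, `isCompactOperator_average`, `exists_invariant_measure`,
`exists_leadingEigenvalue` and `exists_integrable_exp_g`. -/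

noncomputable section

namespace RandomHorseshoe

open ProbabilityTheory

/-! ### Perturbation of a simple eigenvalue of a real operator -/

section Perturbation

variable {E : Type*} [NormedAddCommGroup E] [NormedSpace ℝ E] [CompleteSpace E]

/-- If `1` is a simple eigenvalue of a compact operator `P`, with eigenvector `e` and
left eigenvector `ℓ`, then `1 - P + ℓ(·)e` is invertible. -/
theorem isUnit_one_sub_add_smulRight {P : E →L[ℝ] E} (hP : IsCompactOperator P) {e : E}
    {ℓ : E →L[ℝ] ℝ} (hℓe : ℓ e = 1) (hℓP : ∀ x, ℓ (P x) = ℓ x)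
    (hker : ∀ x, P x = x → ℓ x = 0 → x = 0) :
    IsUnit (1 - P + ℓ.smulRight e) := by
  have hK : IsCompactOperator (P - ℓ.smulRight e) := by
    refine hP.sub ?_
    exact (isCompactOperator_id (E := ℝ)).clm_comp (ContinuousLinearMap.toSpanSingleton ℝ e)
      |>.comp_clm ℓ
  -- Fredholm alternative for `P - ℓ(·)e`: a fixed vector `x` satisfies `ℓ x = 0` (apply `ℓ`), hence
  -- `P x = x`, hence `x = 0`.
  rcases hK.hasEigenvalue_or_mem_resolventSet (μ := (1 : ℝ)) one_ne_zero with h | h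
  · exfalso
    obtain ⟨x, hx⟩ := h.exists_hasEigenvector
    have h1 : P x - ℓ x • e = x := by simpa using hx.apply_eq_smul
    have h2 : ℓ x = 0 := by
      have := congrArg ℓ h1
      simpa [hℓP, hℓe] using this.symm
    exact hx.2 (hker x (by simpa [h2] using h1) h2)
  · rw [spectrum.mem_resolventSet_iff] at h
    convert h using 1
    simp [sub_add]

/-- Perturbation of a simple isolated eigenvalue `1`, with first order bounds. -/
theorem exists_eigenpair_of_near {P : E →L[ℝ] E} {e : E}
    {ℓ : E →L[ℝ] ℝ} (hℓe : ℓ e = 1) (hℓP : ∀ x, ℓ (P x) = ℓ x) (hPe : P e = e)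
    (hunit : IsUnit (1 - P + ℓ.smulRight e)) :
    ∃ η C : ℝ, 0 < η ∧ 0 ≤ C ∧ ∀ T : E →L[ℝ] E, ‖T - P‖ ≤ η →
      ∃ (z : ℝ) (h : E), T h = z • h ∧ ℓ h = 1 ∧ |z - 1| ≤ C * ‖T - P‖ ∧ ‖h - e‖ ≤ 1 / 2 ∧
        ‖h - e‖ ≤ C * ‖T - P‖ := by
  set A₀ : E →L[ℝ] E := 1 - P + ℓ.smulRight e with hA₀
  have hA₀e : A₀ e = e := by simp [hA₀, hPe, hℓe]
  have hinv₀ : ∀ (A : E →L[ℝ] E), IsUnit A → ∀ x, Ring.inverse A (A x) = x := fun A hA x => by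
    have := congrArg (fun B : E →L[ℝ] E => B x) (Ring.inverse_mul_cancel A hA)
    simpa using this
  have hinv₁ : ∀ (A : E →L[ℝ] E), IsUnit A → ∀ x, A (Ring.inverse A x) = x := fun A hA x => by
    have := congrArg (fun B : E →L[ℝ] E => B x) (Ring.mul_inverse_cancel A hA)
    simpa using this
  have hcont : ∀ A : E →L[ℝ] E, IsUnit A →
      ContinuousAt (fun B : E →L[ℝ] E => Ring.inverse B e) A := fun A hA => by
    obtain ⟨u, rfl⟩ := hA
    exact (NormedRing.inverse_continuousAt u).clm_apply continuousAt_const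
  obtain ⟨ε, hε, hball⟩ : ∃ ε > 0, ∀ A : E →L[ℝ] E, ‖A - A₀‖ < ε →
      IsUnit A ∧ ‖(Ring.inverse A : E →L[ℝ] E) e - e‖ < 1 / 2 := by
    have h1 : ∀ᶠ A in 𝓝 A₀, IsUnit A := Units.isOpen.mem_nhds hunit
    have h2 : ∀ᶠ A in 𝓝 A₀, dist ((fun B : E →L[ℝ] E => Ring.inverse B e) A)
        ((fun B : E →L[ℝ] E => Ring.inverse B e) A₀) < 1 / 2 :=
      (hcont A₀ hunit).eventually (Metric.ball_mem_nhds _ (by norm_num))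
    have h3 : Ring.inverse A₀ e = e := by
      conv_lhs => rw [← hA₀e]
      exact hinv₀ A₀ hunit e
    obtain ⟨ε, hε, h⟩ := Metric.eventually_nhds_iff.1 (h1.and h2)
    refine ⟨ε, hε, fun A hA => ?_⟩
    have := h (y := A) (by rwa [dist_eq_norm])
    simpa only [h3, dist_eq_norm] using this
  set m : ℝ := ‖e‖ + 1 / 2 with hm
  have hm0 : 0 ≤ m := by positivity
  set M : ℝ := ‖ℓ‖ * m with hM
  have hM0 : 0 ≤ M := by positivity
  -- The first summand bounds `|z - 1| / τ`. The second bounds `‖h - e‖ / τ`, through `A₀ (h - e) =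
  -- (T - P) h - (z - 1) h`.
  set C : ℝ := M + ‖Ring.inverse A₀‖ * ((M + 1) * m) with hC
  have hMC : M ≤ C := by rw [hC]; linarith [show 0 ≤ ‖Ring.inverse A₀‖ * ((M + 1) * m) by positivity]
  -- The first bound keeps every `A z` used below in the ball where it is invertible; the second
  -- gives `M τ < 1`, so that `z > 0`.
  refine ⟨min (ε / (2 * (M + 1))) (1 / (2 * (M + 1))), C, by positivity, hM0.trans hMC,
    fun T hT => ?_⟩
  set τ := ‖T - P‖ with hτ
  have hτ0 : 0 ≤ τ := norm_nonneg _
  have hT1 : (M + 1) * τ < ε := by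
    have := hT.trans (min_le_left _ _)
    rw [le_div_iff₀ (by positivity)] at this
    nlinarith
  have hT2 : M * τ < 1 := by
    have := hT.trans (min_le_right _ _)
    rw [le_div_iff₀ (by positivity)] at this
    nlinarith
  -- If `A z h = e`, that is `z h - T h + ℓ(h) e = e`, then `(z, h)` is an eigenpair of `T` as soon
  -- as `ℓ h = 1`. This leaves one scalar equation for `z`.
  let A : ℝ → (E →L[ℝ] E) := fun z => z • 1 - T + ℓ.smulRight e
  have hAA : ∀ z, A z - A₀ = (z - 1) • 1 - (T - P) := fun z => by
    simp only [A, hA₀, sub_smul, one_smul]; abel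
  have hAn : ∀ z, |z - 1| ≤ M * τ → ‖A z - A₀‖ < ε := fun z hz => by
    rw [hAA]
    calc ‖(z - 1) • (1 : E →L[ℝ] E) - (T - P)‖ ≤ ‖(z - 1) • (1 : E →L[ℝ] E)‖ + τ := norm_sub_le _ _
      _ ≤ |z - 1| * 1 + τ := by
        rw [norm_smul, Real.norm_eq_abs]
        gcongr
        exact ContinuousLinearMap.norm_id_le
      _ ≤ (M + 1) * τ := by linarith
      _ < ε := hT1
  let h : ℝ → E := fun z => Ring.inverse (A z) e
  have hnorm : ∀ z, |z - 1| ≤ M * τ → ‖h z‖ ≤ m := fun z hz => by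
    have := (hball _ (hAn z hz)).2.le
    calc ‖h z‖ = ‖e + (h z - e)‖ := by congr 1; abel
      _ ≤ ‖e‖ + ‖h z - e‖ := norm_add_le _ _
      _ ≤ m := by rw [hm]; gcongr
  have heq : ∀ z, |z - 1| ≤ M * τ → z • h z - T (h z) + ℓ (h z) • e = e := fun z hz => by
    simpa [A] using hinv₁ _ (hball _ (hAn z hz)).1 e
  have hTP : ∀ z, |z - 1| ≤ M * τ → ‖(T - P) (h z)‖ ≤ τ * m := fun z hz =>
    ((T - P).le_opNorm _).trans (by gcongr; exact hnorm z hz)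
  have hℓ : ∀ z, |z - 1| ≤ M * τ → |z * ℓ (h z) - 1| ≤ M * τ := fun z hz => by
    have h1 := congrArg ℓ (heq z hz)
    have h2 : z * ℓ (h z) - 1 = ℓ ((T - P) (h z)) := by
      simp [hℓe, hℓP] at h1 ⊢
      linarith
    rw [h2, ← Real.norm_eq_abs]
    calc ‖ℓ ((T - P) (h z))‖ ≤ ‖ℓ‖ * ‖(T - P) (h z)‖ := ℓ.le_opNorm _
      _ ≤ ‖ℓ‖ * (τ * m) := by gcongr; exact hTP z hz
      _ = M * τ := by rw [hM]; ring
  have hMτ : 0 ≤ M * τ := by positivity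
  have hmem : ∀ z ∈ Icc (1 - M * τ) (1 + M * τ), |z - 1| ≤ M * τ := fun z hz => by
    rw [abs_le]; constructor <;> linarith [hz.1, hz.2]
  have hcontℓ : ContinuousOn (fun z => ℓ (h z)) (Icc (1 - M * τ) (1 + M * τ)) := fun z hz => by
    have h1 : ContinuousAt A z := by fun_prop
    exact (ℓ.continuous.continuousAt.comp ((hcont _ (hball _ (hAn z (hmem z hz))).1).comp h1)
      : ContinuousAt (fun z => ℓ (h z)) z).continuousWithinAt
  -- Since `|z ℓ(h z) - 1| ≤ M τ`, one has `ℓ(h z) ≤ 1` at `z = 1 + M τ` and `ℓ(h z) ≥ 1` at `z = 1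
  -- - M τ`.
  obtain ⟨z, hz, hz1⟩ : (1 : ℝ) ∈ (fun z => ℓ (h z)) '' Icc (1 - M * τ) (1 + M * τ) := by
    refine intermediate_value_Icc' (by linarith) hcontℓ ⟨?_, ?_⟩
    · have := (abs_le.1 (hℓ (1 + M * τ) (by simp [abs_of_nonneg hMτ]))).2
      by_contra! hlt
      nlinarith
    · have := (abs_le.1 (hℓ (1 - M * τ) (by simp [abs_of_nonneg hMτ]))).1
      by_contra! hlt
      nlinarith
  have hz' := hmem z hz
  refine ⟨z, h z, ?_, hz1, hz'.trans (by gcongr), (hball _ (hAn z hz')).2.le, ?_⟩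
  · have := heq z hz'
    simp only at hz1
    rw [hz1, one_smul, add_eq_right, sub_eq_zero] at this
    exact this.symm
  · have h1 : A₀ (h z - e) = (T - P) (h z) - (z - 1) • h z := by
      have h2 := congrArg (fun B : E →L[ℝ] E => B (h z)) (hAA z)
      have h3 : A z (h z) = e := hinv₁ _ (hball _ (hAn z hz')).1 e
      simp only [sub_apply, h3, smul_apply,
        one_apply_eq_self] at h2 ⊢
      rw [map_sub, hA₀e, ← neg_sub, h2]
      abel
    calc ‖h z - e‖ = ‖Ring.inverse A₀ (A₀ (h z - e))‖ := by rw [hinv₀ A₀ hunit]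
      _ ≤ ‖Ring.inverse A₀‖ * ‖A₀ (h z - e)‖ := ContinuousLinearMap.le_opNorm _ _
      _ ≤ ‖Ring.inverse A₀‖ * (τ * m + M * τ * m) := by
        rw [h1]
        gcongr
        refine (norm_sub_le _ _).trans ?_
        rw [norm_smul, Real.norm_eq_abs]
        gcongr
        · exact hTP z hz'
        · exact hnorm z hz'
      _ ≤ C * τ := by
        rw [hC]
        nlinarith

end Perturbation

/-! ### Averaging operators over continuously varying domains -/

section DomainAverage

variable {Y : Type*} [MetricSpace Y] [MeasurableSpace Y] {ν : Measure Y} {W : Y → Set Y}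

/-- The measurable sets `W x` depend continuously on `x`, up to `ν`-null sets. -/
structure IsContinuousDomain (ν : Measure Y) (W : Y → Set Y) : Prop where
  measurableSet : ∀ x, MeasurableSet (W x)
  eventually_iff : ∀ x, ∀ᵐ y ∂ν, ∀ᶠ x' in 𝓝 x, (y ∈ W x' ↔ y ∈ W x)

namespace IsContinuousDomain

theorem continuous_setIntegral (hW : IsContinuousDomain ν W) {G : Type*} [NormedAddCommGroup G]
    [NormedSpace ℝ G] {F : Y → G} (hF : Integrable F ν) :
    Continuous fun x => ∫ y in W x, F y ∂ν := by
  simp_rw [← integral_indicator (hW.measurableSet _)]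
  refine continuous_iff_continuousAt.2 fun x => ?_
  refine tendsto_integral_filter_of_dominated_convergence (fun y => ‖F y‖)
    (Eventually.of_forall fun x' => hF.aestronglyMeasurable.indicator (hW.measurableSet x'))
    (Eventually.of_forall fun x' => Eventually.of_forall fun y => norm_indicator_le_norm_self _ _)
    hF.norm ?_
  filter_upwards [hW.eventually_iff x] with y hy
  refine tendsto_const_nhds.congr' ?_
  filter_upwards [hy] with x' hx'
  by_cases h : y ∈ W x <;> simp [h, hx']

/-- This integral is the common modulus of continuity, at `x`, of the averages of all functions in
the unit ball. -/
theorem tendsto_integral_norm_indicator_sub (hW : IsContinuousDomain ν W) {F : Y → ℝ}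
    (hF : Integrable F ν) (x : Y) :
    Tendsto (fun x' => ∫ y, ‖(W x').indicator F y - (W x).indicator F y‖ ∂ν) (𝓝 x) (𝓝 0) := by
  have h0 : ∫ _, (0 : ℝ) ∂ν = 0 := integral_zero _ _
  rw [← h0]
  refine tendsto_integral_filter_of_dominated_convergence (fun y => ‖F y‖ + ‖F y‖)
    (Eventually.of_forall fun x' => ((hF.aestronglyMeasurable.indicator
      (hW.measurableSet x')).sub (hF.aestronglyMeasurable.indicator (hW.measurableSet x))).norm)
    (Eventually.of_forall fun x' => Eventually.of_forall fun y => ?_) (hF.norm.add hF.norm) ?_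
  · rw [norm_norm]
    exact (norm_sub_le _ _).trans
      (add_le_add (norm_indicator_le_norm_self _ _) (norm_indicator_le_norm_self _ _))
  · filter_upwards [hW.eventually_iff x] with y hy
    refine tendsto_const_nhds.congr' ?_
    filter_upwards [hy] with x' hx'
    by_cases h : y ∈ W x <;> simp [h, hx']

variable (𝕜 : Type*) [RCLike 𝕜] [CompactSpace Y] [BorelSpace Y] {w : Y → ℝ}

theorem _root_.RandomHorseshoe.integrable_weight_mul (hw : Integrable w ν) (h : C(Y, 𝕜)) :
    Integrable (fun y => (w y : 𝕜) * h y) ν :=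
  hw.ofReal.mul_bdd (c := ‖h‖) h.continuous.aestronglyMeasurable
    (Eventually.of_forall h.norm_coe_le_norm)

theorem norm_setIntegral_weight_le (hw : Integrable w ν) (h : C(Y, 𝕜)) (x : Y) :
    ‖∫ y in W x, (w y : 𝕜) * h y ∂ν‖ ≤ (∫ y, ‖w y‖ ∂ν) * ‖h‖ := by
  calc ‖∫ y in W x, (w y : 𝕜) * h y ∂ν‖ ≤ ∫ y in W x, ‖(w y : 𝕜) * h y‖ ∂ν :=
        norm_integral_le_integral_norm _
    _ ≤ ∫ y, ‖(w y : 𝕜) * h y‖ ∂ν :=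
        setIntegral_le_integral (integrable_weight_mul 𝕜 hw h).norm
          (Eventually.of_forall fun y => norm_nonneg _)
    _ ≤ ∫ y, ‖w y‖ * ‖h‖ ∂ν := by
        refine integral_mono (integrable_weight_mul 𝕜 hw h).norm (hw.norm.mul_const _) fun y => ?_
        simp only [norm_mul, RCLike.norm_ofReal, Real.norm_eq_abs]
        gcongr
        exact h.norm_coe_le_norm y
    _ = _ := integral_mul_const _ _

/-- The operator `h ↦ (x ↦ ∫_{W x} w h dν)` on continuous functions. -/
def average (hW : IsContinuousDomain ν W) (hw : Integrable w ν) : C(Y, 𝕜) →L[𝕜] C(Y, 𝕜) :=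
  LinearMap.mkContinuous
    { toFun := fun h => ⟨fun x => ∫ y in W x, (w y : 𝕜) * h y ∂ν,
        hW.continuous_setIntegral (integrable_weight_mul 𝕜 hw h)⟩
      map_add' := fun h₁ h₂ => by
        ext x
        simp only [ContinuousMap.coe_mk, ContinuousMap.add_apply, mul_add]
        exact integral_add (integrable_weight_mul 𝕜 hw h₁).restrict
          (integrable_weight_mul 𝕜 hw h₂).restrict
      map_smul' := fun a h => by
        ext x
        simp only [ContinuousMap.coe_mk, ContinuousMap.smul_apply, smul_eq_mul, RingHom.id_apply]
        rw [← integral_const_mul]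
        congr 1 with y
        ring }
    (∫ y, ‖w y‖ ∂ν) fun h => by
      refine (ContinuousMap.norm_le _ (by positivity)).2 fun x => ?_
      exact norm_setIntegral_weight_le 𝕜 hw h x

@[simp] theorem average_apply (hW : IsContinuousDomain ν W) (hw : Integrable w ν) (h : C(Y, 𝕜))
    (x : Y) : hW.average 𝕜 hw h x = ∫ y in W x, (w y : 𝕜) * h y ∂ν := rfl

theorem norm_average_le (hW : IsContinuousDomain ν W) (hw : Integrable w ν) :
    ‖hW.average 𝕜 hw‖ ≤ ∫ y, ‖w y‖ ∂ν :=
  LinearMap.mkContinuous_norm_le _ (by positivity) _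

theorem norm_average_sub_average_le (hW : IsContinuousDomain ν W) {w' : Y → ℝ}
    (hw : Integrable w ν) (hw' : Integrable w' ν) :
    ‖hW.average 𝕜 hw - hW.average 𝕜 hw'‖ ≤ ∫ y, ‖w y - w' y‖ ∂ν := by
  have heq : hW.average 𝕜 hw - hW.average 𝕜 hw' = hW.average 𝕜 (hw.sub hw') := ?_
  · rw [heq]
    exact hW.norm_average_le 𝕜 (hw.sub hw')
  ext h x
  simp only [sub_apply, ContinuousMap.sub_apply, average_apply, Pi.sub_apply]
  rw [← integral_sub (integrable_weight_mul 𝕜 hw h).restrict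
    (integrable_weight_mul 𝕜 hw' h).restrict]
  congr 1 with y
  push_cast
  ring

/-- Arzelà–Ascoli: the image of the unit ball is bounded by `∫ ‖w‖`, and its modulus of continuity
involves only `w` and `W`, not `h`. -/
theorem isCompactOperator_average (hW : IsContinuousDomain ν W) (hw : Integrable w ν) :
    IsCompactOperator (hW.average 𝕜 hw) := by
  set T := hW.average 𝕜 hw
  have hbound : ∀ h ∈ Metric.ball (0 : C(Y, 𝕜)) 1, ∀ x, ‖T h x‖ ≤ ∫ y, ‖w y‖ ∂ν := fun h hh x => by
    refine (norm_setIntegral_weight_le 𝕜 hw h x).trans (mul_le_of_le_one_right (by positivity) ?_)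
    simpa using (mem_ball_zero_iff.1 hh).le
  have hequi : Equicontinuous ((↑) : (T '' Metric.ball 0 1) → Y → 𝕜) := fun x => by
    refine Metric.equicontinuousAt_of_continuity_modulus _
      (hW.tendsto_integral_norm_indicator_sub hw x) _ (Eventually.of_forall fun x' => ?_)
    rintro ⟨_, h, hh, rfl⟩
    have hh1 : ‖h‖ ≤ 1 := (mem_ball_zero_iff.1 hh).le
    have hint := integrable_weight_mul 𝕜 hw h
    rw [dist_comm, dist_eq_norm]
    change ‖(∫ y in W x', (w y : 𝕜) * h y ∂ν) - ∫ y in W x, (w y : 𝕜) * h y ∂ν‖ ≤ _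
    rw [← integral_indicator (hW.measurableSet _), ← integral_indicator (hW.measurableSet _),
      ← integral_sub (hint.indicator (hW.measurableSet _)) (hint.indicator (hW.measurableSet _))]
    refine (norm_integral_le_integral_norm _).trans ?_
    refine integral_mono ((hint.indicator (hW.measurableSet _)).sub
      (hint.indicator (hW.measurableSet _))).norm ((hw.indicator (hW.measurableSet _)).sub
      (hw.indicator (hW.measurableSet _))).norm fun y => ?_
    have hhy : ‖h y‖ ≤ 1 := (h.norm_coe_le_norm y).trans hh1
    have hmul : |w y| * ‖h y‖ ≤ |w y| := mul_le_of_le_one_right (abs_nonneg _) hhy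
    by_cases h1 : y ∈ W x <;> by_cases h2 : y ∈ W x' <;> simp [h1, h2, hmul]
  let Φ := ContinuousMap.isometryEquivBoundedOfCompact Y 𝕜
  have hK := BoundedContinuousFunction.arzela_ascoli
    (Metric.closedBall (0 : 𝕜) (∫ y, ‖w y‖ ∂ν)) (isCompact_closedBall _ _)
    (Φ '' (T '' Metric.ball 0 1)) ?_ ?_
  · refine (isCompactOperator_iff_image_ball_subset_compact (T : C(Y, 𝕜) →ₗ[𝕜] C(Y, 𝕜))
      one_pos).2 ⟨_, hK.image Φ.symm.continuous, fun f hf => ⟨Φ f, subset_closure ⟨f, hf, rfl⟩, ?_⟩⟩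
    exact Φ.symm_apply_apply f
  · rintro _ x ⟨_, ⟨h, hh, rfl⟩, rfl⟩
    exact mem_closedBall_zero_iff.2 (hbound h hh x)
  · have hlift : ∀ f : Φ '' (T '' Metric.ball 0 1), ∃ k : T '' Metric.ball 0 1,
        ∀ x, f.1 x = k.1 x := by
      rintro ⟨_, k, hk, rfl⟩
      exact ⟨⟨k, hk⟩, fun x => rfl⟩
    choose u hu using hlift
    have heq : ((↑) : Φ '' (T '' Metric.ball 0 1) → Y → 𝕜) =
        ((↑) : (T '' Metric.ball 0 1) → Y → 𝕜) ∘ u := by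
      ext f x
      exact hu f x
    rw [heq]
    exact hequi.comp u

end IsContinuousDomain

end DomainAverage

/-! ### Spectral radius from a positive eigenfunction -/

section SpectralRadius

variable {Y : Type*} [TopologicalSpace Y] [CompactSpace Y]

/-- A compact operator dominated by a positive one with a positive eigenfunction `h` has
spectral radius at most the eigenvalue of `h`. -/
theorem spectralRadius_le_of_dominated {T : C(Y, ℂ) →L[ℂ] C(Y, ℂ)} (hT : IsCompactOperator T)
    {h : C(Y, ℝ)} (hpos : ∀ x, 0 < h x) {z : ℝ}
    (hdom : ∀ (v : C(Y, ℂ)) (t : ℝ), (∀ x, ‖v x‖ ≤ t * h x) → ∀ x, ‖T v x‖ ≤ z * (t * h x)) :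
    spectralRadius ℂ T ≤ ENNReal.ofReal z := by
  refine iSup₂_le fun ζ hζ => ?_
  rcases eq_or_ne ζ 0 with rfl | hζ0
  · simp
  obtain ⟨v, hv⟩ := ((hT.hasEigenvalue_iff_mem_spectrum hζ0).2 hζ).exists_hasEigenvector
  have hTv : T v = ζ • v := hv.apply_eq_smul
  obtain ⟨y, hy⟩ : ∃ y, v y ≠ 0 := by
    by_contra! hcon
    exact hv.2 (ContinuousMap.ext hcon)
  -- At a maximum `x` of `‖v‖ / h`, with value `t`, domination reads `‖ζ‖ ‖v x‖ ≤ z t h(x) = z ‖v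
  -- x‖`.
  obtain ⟨x, -, hx⟩ := isCompact_univ.exists_isMaxOn (f := fun x => ‖v x‖ / h x) ⟨y, mem_univ y⟩
    ((by fun_prop : Continuous fun x => ‖v x‖).div h.continuous
      fun x => (hpos x).ne').continuousOn
  have hle : ∀ u, ‖v u‖ ≤ ‖v x‖ / h x * h u := fun u => by
    rw [← div_le_iff₀ (hpos u)]
    exact hx (mem_univ u)
  have hvx : 0 < ‖v x‖ := by
    by_contra! hcon
    have := hle y
    rw [le_antisymm hcon (norm_nonneg _)] at this
    simp [hy] at this
  have := hdom v _ hle x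
  rw [hTv, div_mul_cancel₀ _ (hpos x).ne', ContinuousMap.smul_apply, smul_eq_mul, norm_mul] at this
  rw [← enorm_eq_nnnorm, ← ofReal_norm]
  exact ENNReal.ofReal_le_ofReal (le_of_mul_le_mul_right this hvx)

end SpectralRadius

/-! ### Invariant measures and harmonic functions -/

section Invariant

variable {Y : Type*} [MetricSpace Y] [CompactSpace Y] [MeasurableSpace Y] [BorelSpace Y]

theorem integral_bind_kernel {α β : Type*} [MeasurableSpace α] [MeasurableSpace β]
    {m : Measure α} {κ : Kernel α β} {f : β → ℝ} (hf : Integrable f (m.bind κ)) :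
    ∫ y, f y ∂(m.bind κ) = ∫ x, ∫ y, f y ∂κ x ∂m := by
  rw [Measure.comp_eq_comp_const_apply] at hf ⊢
  rw [Kernel.integral_comp hf, Kernel.const_apply]

theorem integrable_continuousMap (m : Measure Y) [IsFiniteMeasure m] (h : C(Y, ℝ)) :
    Integrable h m :=
  h.continuous.integrable_of_hasCompactSupport (HasCompactSupport.of_compactSpace _)

/-- Krylov–Bogoliubov: a Feller kernel on a compact space has an invariant probability measure
which moreover integrates each harmonic function to its value at a given point. -/
theorem exists_invariant_measure {κ : Kernel Y Y} [IsMarkovKernel κ] {P : C(Y, ℝ) → C(Y, ℝ)}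
    (hP : ∀ f x, P f x = ∫ y, f y ∂κ x) (x₀ : Y) :
    ∃ m : Measure Y, IsProbabilityMeasure m ∧ m.bind κ = m ∧
      ∀ h : C(Y, ℝ), P h = h → ∫ y, h y ∂m = h x₀ := by
  let iter : ℕ → Measure Y := fun k => Nat.rec (Measure.dirac x₀) (fun _ m => m.bind κ) k
  have hprob : ∀ k, IsProbabilityMeasure (iter k) := fun k => by
    induction k with
    | zero => exact Measure.dirac.isProbabilityMeasure
    | succ k ih => exact (inferInstance : IsProbabilityMeasure (κ ∘ₘ iter k))
  have hbind : ∀ (m : Measure Y) [IsProbabilityMeasure m] (f : C(Y, ℝ)),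
      ∫ y, f y ∂(m.bind κ) = ∫ y, P f y ∂m := fun m _ f => by
    have : IsProbabilityMeasure (m.bind κ) := (inferInstance : IsProbabilityMeasure (κ ∘ₘ m))
    rw [integral_bind_kernel (integrable_continuousMap _ f)]
    simp_rw [hP]
  let avg : ℕ → Measure Y := fun N =>
    ((N + 1 : ℕ) : ENNReal)⁻¹ • ∑ k ∈ Finset.range (N + 1), iter k
  have havg : ∀ N, IsProbabilityMeasure (avg N) := fun N => ⟨by
    simp only [avg, Measure.smul_apply, Measure.coe_finsetSum, Finset.sum_apply, measure_univ,
      Finset.sum_const, Finset.card_range, smul_eq_mul, nsmul_eq_mul, mul_one]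
    exact ENNReal.inv_mul_cancel (by simp) (ENNReal.natCast_ne_top _)⟩
  have hint : ∀ N (f : C(Y, ℝ)), ∫ y, f y ∂(avg N) =
      ((N + 1 : ℕ) : ℝ)⁻¹ * ∑ k ∈ Finset.range (N + 1), ∫ y, f y ∂(iter k) := fun N f => by
    simp only [avg]
    rw [integral_smul_measure, integral_finsetSum_measure
      fun k _ => integrable_continuousMap _ f, smul_eq_mul, ENNReal.toReal_inv,
      ENNReal.toReal_natCast]
  let A : ℕ → ProbabilityMeasure Y := fun N => ⟨avg N, havg N⟩
  -- The space of probability measures on the compact space `Y` is compact, so the Cesàro averages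
  -- converge along an ultrafilter.
  let U : Ultrafilter (ProbabilityMeasure Y) := Ultrafilter.map A (Ultrafilter.of atTop)
  have hU := U.le_nhds_lim
  set m : ProbabilityMeasure Y := U.lim
  have hlim : ∀ f : C(Y, ℝ), Tendsto (fun N => ∫ y, f y ∂(avg N)) ((Ultrafilter.of atTop : Ultrafilter ℕ) : Filter ℕ)
      (𝓝 (∫ y, f y ∂(m : Measure Y))) := fun f =>
    ProbabilityMeasure.tendsto_iff_forall_integral_tendsto.1 (show Tendsto A _ _ from hU)
      (BoundedContinuousFunction.mkOfCompact f)
  refine ⟨m, inferInstance, ?_, fun h hh => ?_⟩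
  · have : IsProbabilityMeasure ((m : Measure Y).bind κ) :=
      (inferInstance : IsProbabilityMeasure (κ ∘ₘ (m : Measure Y)))
    refine ext_of_forall_integral_eq_of_IsFiniteMeasure fun f => ?_
    let f' : C(Y, ℝ) := f.toContinuousMap
    change ∫ y, f' y ∂_ = ∫ y, f' y ∂_
    rw [hbind]
    -- The sum telescopes to two boundary terms, each at most `‖f'‖`, divided by `N + 1`.
    have hdiff : Tendsto (fun N => ∫ y, P f' y ∂(avg N) - ∫ y, f' y ∂(avg N)) atTop (𝓝 0) := by
      have hle : ∀ k, ‖∫ y, f' y ∂(iter k)‖ ≤ ‖f'‖ := fun k => by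
        have := norm_integral_le_of_norm_le_const (μ := iter k)
          (Eventually.of_forall f'.norm_coe_le_norm)
        simpa using this
      refine squeeze_zero_norm (a := fun N : ℕ => ((N + 1 : ℕ) : ℝ)⁻¹ * (‖f'‖ + ‖f'‖))
        (fun N => ?_) ?_
      · rw [hint, hint, ← mul_sub, ← Finset.sum_sub_distrib]
        have hstep : ∀ k, ∫ y, P f' y ∂(iter k) - ∫ y, f' y ∂(iter k) =
            ∫ y, f' y ∂(iter (k + 1)) - ∫ y, f' y ∂(iter k) := fun k => by rw [← hbind]
        simp_rw [hstep]
        rw [Finset.sum_range_sub (fun k => ∫ y, f' y ∂(iter k)), norm_mul, norm_inv,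
          RCLike.norm_natCast]
        gcongr
        exact (norm_sub_le _ _).trans (add_le_add (hle (N + 1)) (hle 0))
      · simpa using ((tendsto_inv_atTop_zero.comp tendsto_natCast_atTop_atTop).comp
          (tendsto_add_atTop_nat 1)).mul_const (‖f'‖ + ‖f'‖)
    have h1 := (hlim (P f')).sub (hlim f')
    exact sub_eq_zero.1 (tendsto_nhds_unique h1 (hdiff.mono_left (Ultrafilter.of_le _)))
  · have hk : ∀ k, ∫ y, h y ∂(iter k) = h x₀ := fun k => by
      induction k with
      | zero => exact integral_dirac _ _
      | succ k ih =>
        change ∫ y, h y ∂((iter k).bind κ) = _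
        rw [hbind, hh, ih]
    refine tendsto_nhds_unique (hlim h) ?_
    have : ∀ N, ∫ y, h y ∂(avg N) = h x₀ := fun N => by
      rw [hint]
      simp only [hk, Finset.sum_const, Finset.card_range, nsmul_eq_mul]
      field_simp
    simp_rw [this]
    exact tendsto_const_nhds

end Invariant

/-! ### The Markov kernel of a continuous domain -/

section DomainKernel

variable {Y : Type*} [MetricSpace Y] [MeasurableSpace Y] [BorelSpace Y]
  {ν : Measure Y} [IsFiniteMeasure ν] {W : Y → Set Y}

/-- The kernel `x ↦ ν|_{W x}`. -/
def IsContinuousDomain.kernel (hW : IsContinuousDomain ν W) : Kernel Y Y where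
  toFun x := ν.restrict (W x)
  measurable' := by
    refine Measure.measurable_of_measurable_coe _ fun A hA => ?_
    -- Measurability in `x` follows from continuity: `x ↦ ν (W x ∩ A)` is continuous for every
    -- measurable `A`.
    have h1 : Continuous fun x => ∫ y in W x, A.indicator (fun _ => (1 : ℝ)) y ∂ν :=
      hW.continuous_setIntegral ((integrable_const _).indicator hA)
    have h2 : ∀ x, ν.restrict (W x) A =
        ENNReal.ofReal (∫ y in W x, A.indicator (fun _ => (1 : ℝ)) y ∂ν) := fun x => by
      rw [integral_indicator_const _ hA]
      simp
    simp_rw [h2]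
    exact h1.measurable.ennreal_ofReal

theorem IsContinuousDomain.kernel_apply (hW : IsContinuousDomain ν W) (x : Y) :
    hW.kernel x = ν.restrict (W x) := rfl

/-- A stationary `μ` is a `μ`-average of restrictions of `ν`. This transfers integrability and
almost-everywhere statements from `ν` to `μ`. -/
theorem IsContinuousDomain.le_of_bind_eq (hW : IsContinuousDomain ν W) {μ : Measure Y}
    [IsProbabilityMeasure μ] (hμ : μ.bind hW.kernel = μ) : μ ≤ ν := by
  refine Measure.le_iff.2 fun A hA => ?_
  rw [← hμ, Measure.bind_apply hA hW.kernel.aemeasurable]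
  calc ∫⁻ x, hW.kernel x A ∂μ ≤ ∫⁻ _, ν A ∂μ :=
        lintegral_mono fun x => Measure.restrict_apply_le _ _
    _ = ν A := by simp

end DomainKernel

/-! ### Taylor bounds for the exponential with an exponential moment as majorant -/

theorem abs_le_inv_mul_exp {b : ℝ} (hb : 0 < b) (t : ℝ) : |t| ≤ b⁻¹ * Real.exp (b * |t|) := by
  rw [le_inv_mul_iff₀ hb]
  linarith [Real.add_one_le_exp (b * |t|)]

theorem abs_exp_sub_one_le_mul_exp (x : ℝ) : |Real.exp x - 1| ≤ |x| * Real.exp |x| := by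
  have h : ‖((Real.exp x - 1 : ℝ) : ℂ)‖ ≤ |x| * Real.exp |x| := by
    simpa using Complex.norm_exp_sub_sum_le_norm_mul_exp (x : ℂ) 1
  rwa [Complex.norm_real, Real.norm_eq_abs] at h

theorem abs_exp_sub_one_sub_le_mul_exp (x : ℝ) :
    |Real.exp x - 1 - x| ≤ |x| ^ 2 * Real.exp |x| := by
  have h : ‖((Real.exp x - 1 - x : ℝ) : ℂ)‖ ≤ |x| ^ 2 * Real.exp |x| := by
    simpa [Finset.sum_range_succ, sub_sub] using
      Complex.norm_exp_sub_sum_le_norm_mul_exp (x : ℂ) 2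
  rwa [Complex.norm_real, Real.norm_eq_abs] at h

theorem abs_exp_mul_sub_one_le {a θ : ℝ} (ha : 0 < a) (hθ : 0 ≤ θ) (hθa : θ ≤ a / 3) (t : ℝ) :
    |Real.exp (θ * t) - 1| ≤ θ * (3 / a * Real.exp (a * |t|)) := by
  have h1 := abs_exp_sub_one_le_mul_exp (θ * t)
  rw [abs_mul, abs_of_nonneg hθ] at h1
  refine h1.trans ?_
  rw [mul_assoc]
  refine mul_le_mul_of_nonneg_left ?_ hθ
  calc |t| * Real.exp (θ * |t|) ≤ (a / 3)⁻¹ * Real.exp (a / 3 * |t|) * Real.exp (a / 3 * |t|) := by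
        gcongr
        exact abs_le_inv_mul_exp (by positivity) t
    _ = 3 / a * Real.exp (2 * a / 3 * |t|) := by
        rw [inv_div, mul_assoc, ← Real.exp_add]
        ring_nf
    _ ≤ 3 / a * Real.exp (a * |t|) := by
        gcongr
        linarith

/-- The threshold `a / 3` splits the exponent `a`: each of the two factors `|t|` costs one third,
and `exp (θ |t|)` costs the last. -/
theorem abs_exp_mul_sub_one_sub_le {a θ : ℝ} (ha : 0 < a) (hθ : 0 ≤ θ) (hθa : θ ≤ a / 3) (t : ℝ) :
    |Real.exp (θ * t) - 1 - θ * t| ≤ θ ^ 2 * ((3 / a) ^ 2 * Real.exp (a * |t|)) := by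
  have h1 := abs_exp_sub_one_sub_le_mul_exp (θ * t)
  rw [abs_mul, abs_of_nonneg hθ, mul_pow] at h1
  refine h1.trans ?_
  rw [mul_assoc]
  refine mul_le_mul_of_nonneg_left ?_ (sq_nonneg θ)
  calc |t| ^ 2 * Real.exp (θ * |t|)
      ≤ ((a / 3)⁻¹ * Real.exp (a / 3 * |t|)) ^ 2 * Real.exp (a / 3 * |t|) := by
        gcongr
        exact abs_le_inv_mul_exp (by positivity) t
    _ = (3 / a) ^ 2 * Real.exp (a * |t|) := by
        rw [inv_div, mul_pow, mul_assoc, ← Real.exp_nat_mul, ← Real.exp_add]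
        ring_nf

/-! ### The leading eigenvalue and its expansion -/

section LeadingEigenvalue

variable {Y : Type*} [MetricSpace Y] [CompactSpace Y] [MeasurableSpace Y] [BorelSpace Y]

/-- Integration against a probability measure, as a functional on continuous functions. -/
def integralFunctional (μ : Measure Y) [IsProbabilityMeasure μ] : C(Y, ℝ) →L[ℝ] ℝ :=
  LinearMap.mkContinuous
    { toFun := fun h => ∫ y, h y ∂μ
      map_add' := fun h₁ h₂ =>
        integral_add (integrable_continuousMap μ h₁) (integrable_continuousMap μ h₂)
      map_smul' := fun a h => integral_const_mul a _ } 1 fun h => by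
    have := norm_integral_le_of_norm_le_const (μ := μ) (Eventually.of_forall h.norm_coe_le_norm)
    simpa using this

@[simp] theorem integralFunctional_apply (μ : Measure Y) [IsProbabilityMeasure μ] (h : C(Y, ℝ)) :
    integralFunctional μ h = ∫ y, h y ∂μ := rfl

variable {ν : Measure Y} {W : Y → Set Y} {μ : Measure Y}

/-- A positive eigenfunction of the real operator yields the leading eigenvalue of the
complex one. -/
theorem IsContinuousDomain.isLeadingEigenvalue_average (hW : IsContinuousDomain ν W) [Nonempty Y]
    {w : Y → ℝ} (hw : Integrable w ν) (hw0 : ∀ y, 0 ≤ w y) {h : C(Y, ℝ)} (hpos : ∀ y, 0 < h y)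
    {z : ℝ} (hz : hW.average ℝ hw h = z • h) : IsLeadingEigenvalue (hW.average ℂ hw) z := by
  have hzx : ∀ x, ∫ y in W x, w y * h y ∂ν = z * h x := fun x =>
    congrArg (fun u : C(Y, ℝ) => u x) hz
  have hz0 : 0 ≤ z := by
    obtain ⟨x⟩ := ‹Nonempty Y›
    refine nonneg_of_mul_nonneg_left ?_ (hpos x)
    rw [← hzx]
    exact integral_nonneg fun y => mul_nonneg (hw0 y) (hpos y).le
  let hc : C(Y, ℂ) := ⟨fun x => (h x : ℂ), by fun_prop⟩
  have heig : Module.End.HasEigenvalue (hW.average ℂ hw : C(Y, ℂ) →ₗ[ℂ] C(Y, ℂ)) (z : ℂ) := by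
    refine Module.End.hasEigenvalue_of_hasEigenvector (x := hc)
      ⟨Module.End.mem_eigenspace_iff.2 ?_, fun h0 => ?_⟩
    · ext x
      change ∫ y in W x, (w y : ℂ) * (h y : ℂ) ∂ν = z * h x
      rw [← Complex.ofReal_mul, ← hzx, ← integral_complex_ofReal]
      simp
    · obtain ⟨x⟩ := ‹Nonempty Y›
      have := congrArg (fun u : C(Y, ℂ) => u x) h0
      exact (hpos x).ne' (by simpa [hc] using this)
  refine ⟨heig, le_antisymm ?_ ?_, hz0⟩
  -- As `w ≥ 0`, `‖v‖ ≤ t h` implies `‖w v‖ ≤ t w h`, whose average is `t z h`.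
  · refine spectralRadius_le_of_dominated (hW.isCompactOperator_average ℂ hw) hpos fun v t hv x => ?_
    calc ‖∫ y in W x, (w y : ℂ) * v y ∂ν‖ ≤ ∫ y in W x, ‖(w y : ℂ) * v y‖ ∂ν :=
          norm_integral_le_integral_norm _
      _ ≤ ∫ y in W x, t * (w y * h y) ∂ν := by
          refine integral_mono (integrable_weight_mul ℂ hw v).norm.restrict
            ((integrable_weight_mul ℝ hw h).restrict.const_mul t) fun y => ?_
          simp only [norm_mul, Complex.norm_real, Real.norm_eq_abs, abs_of_nonneg (hw0 y)]
          nlinarith [hv y, hw0 y]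
      _ = z * (t * h x) := by rw [integral_const_mul, hzx]; ring
  · have hmem : (z : ℂ) ∈ spectrum ℂ (hW.average ℂ hw) := by
      rw [ContinuousLinearMap.spectrum_eq]
      exact heig.mem_spectrum
    have := le_iSup₂ (f := fun (k : ℂ) (_ : k ∈ spectrum ℂ (hW.average ℂ hw)) => (‖k‖₊ : ENNReal))
      (z : ℂ) hmem
    refine le_trans (le_of_eq ?_) this
    rw [← enorm_eq_nnnorm, ← ofReal_norm, Complex.norm_real, Real.norm_eq_abs, abs_of_nonneg hz0]

variable [IsFiniteMeasure ν]

/-- Fubini and stationarity, with `μ ≤ ν` supplying integrability. The case `w = 1` makes `μ` a left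
eigenvector; the case `w = exp (θ g)` gives the formula for the eigenvalue. -/
theorem IsContinuousDomain.integral_average (hW : IsContinuousDomain ν W) [IsProbabilityMeasure μ]
    (hμ : μ.bind hW.kernel = μ) {w : Y → ℝ} (hw : Integrable w ν) (h : C(Y, ℝ)) :
    ∫ x, hW.average ℝ hw h x ∂μ = ∫ y, w y * h y ∂μ := by
  have hint : Integrable (fun y => w y * h y) (μ.bind hW.kernel) := by
    rw [hμ]
    exact (integrable_weight_mul ℝ hw h).mono_measure (hW.le_of_bind_eq hμ)
  conv_rhs => rw [← hμ, integral_bind_kernel hint]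
  rfl

/-- First order expansion of the leading eigenvalue of the twisted averaging operators with
weight `exp (θ g)`, at `θ = 0`, for a uniquely ergodic averaging kernel. -/
theorem IsContinuousDomain.exists_leadingEigenvalue (hW : IsContinuousDomain ν W) [Nonempty Y]
    (hν : ∀ x, ν (W x) = 1) [IsProbabilityMeasure μ] (hμ : μ.bind hW.kernel = μ)
    (huniq : ∀ m : Measure Y, IsProbabilityMeasure m → m.bind hW.kernel = m → m = μ)
    {g : Y → ℝ} (hg : AEStronglyMeasurable g ν) {a : ℝ} (ha : 0 < a)
    (hint : Integrable (fun y => Real.exp (a * |g y|)) ν) :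
    ∃ C θ₀ : ℝ, 0 < θ₀ ∧ ∀ θ, 0 < θ → θ < θ₀ →
      ∃ (hw : Integrable (fun y => Real.exp (θ * g y)) ν) (r : ℝ),
        IsLeadingEigenvalue (hW.average ℂ hw) r ∧ |r - (1 + θ * ∫ y, g y ∂μ)| ≤ C * θ ^ 2 := by
  have hkernel : IsMarkovKernel hW.kernel := ⟨fun x => ⟨by simp [hW.kernel_apply, hν]⟩⟩
  have hμν : μ ≤ ν := hW.le_of_bind_eq hμ
  set D := ∫ y, Real.exp (a * |g y|) ∂ν with hD
  have hD0 : 0 ≤ D := integral_nonneg fun y => (Real.exp_pos _).le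
  have hDμ : ∫ y, Real.exp (a * |g y|) ∂μ ≤ D :=
    integral_mono_measure hμν (Eventually.of_forall fun y => (Real.exp_pos _).le) hint
  have hintμ : Integrable (fun y => Real.exp (a * |g y|)) μ := hint.mono_measure hμν
  have hone : Integrable (fun _ : Y => (1 : ℝ)) ν := integrable_const _
  set P := hW.average ℝ hone with hP
  set ℓ := integralFunctional μ with hℓ
  have hPapply : ∀ (f : C(Y, ℝ)) x, P f x = ∫ y, f y ∂hW.kernel x := fun f x => by
    simp [hP, hW.kernel_apply]
  have hℓ1 : ℓ 1 = 1 := by simp [hℓ]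
  have hℓP : ∀ f, ℓ (P f) = ℓ f := fun f => by
    simp [hℓ, hP, hW.integral_average hμ hone f, -average_apply]
  have hP1 : P 1 = 1 := by
    ext x
    simp [hPapply]
  -- For each `x`, Krylov–Bogoliubov started at `x` yields an invariant measure giving a harmonic
  -- `f` the integral `f x`. By uniqueness it is `μ`, so `f` is constant, equal to `ℓ f`.
  have hker : ∀ f, P f = f → ℓ f = 0 → f = 0 := fun f hf h0 => by
    ext x
    obtain ⟨m, hm, hmb, hmx⟩ := exists_invariant_measure hPapply x
    rw [ContinuousMap.zero_apply, ← hmx f hf, huniq m hm hmb]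
    exact h0
  obtain ⟨η, C, hη, hC, hpert⟩ := exists_eigenpair_of_near hℓ1 hℓP hP1
    (isUnit_one_sub_add_smulRight (hW.isCompactOperator_average ℝ hone) hℓ1 hℓP hker)
  set b := 3 / a with hb
  have hb0 : 0 < b := by positivity
  refine ⟨b ^ 2 * D + C * (b * D) * (b * D), min (a / 3) (η / (b * D + 1)), by positivity,
    fun θ hθ hθ₀ => ?_⟩
  have hθa : θ ≤ a / 3 := hθ₀.le.trans (min_le_left _ _)
  have hθη : θ * (b * D) ≤ η := by
    have h1 := hθ₀.le.trans (min_le_right _ _)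
    rw [le_div_iff₀ (by positivity)] at h1
    nlinarith
  have hmeas : AEStronglyMeasurable (fun y => Real.exp (θ * g y)) ν :=
    Real.continuous_exp.comp_aestronglyMeasurable (hg.const_mul θ)
  have hw : Integrable (fun y => Real.exp (θ * g y)) ν := by
    refine hint.mono' hmeas (Eventually.of_forall fun y => ?_)
    rw [Real.norm_eq_abs, Real.abs_exp]
    refine Real.exp_le_exp.2 ?_
    calc θ * g y ≤ θ * |g y| := by gcongr; exact le_abs_self _
      _ ≤ a * |g y| := by gcongr; linarith
  have hTP : ‖hW.average ℝ hw - P‖ ≤ θ * (b * D) := by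
    refine (hW.norm_average_sub_average_le ℝ hw hone).trans ?_
    rw [hD, ← integral_const_mul, ← integral_const_mul]
    exact integral_mono (hw.sub hone).norm ((hint.const_mul _).const_mul _)
      fun y => abs_exp_mul_sub_one_le ha hθ.le hθa (g y)
  obtain ⟨z, h, hz, hℓh, -, hhalf, hh⟩ := hpert _ (hTP.trans hθη)
  have hh1 : ∀ y, |h y - 1| ≤ ‖h - 1‖ := fun y => (h - 1).norm_coe_le_norm y
  have hpos : ∀ y, 0 < h y := fun y => by
    have := (abs_le.1 ((hh1 y).trans hhalf)).1
    linarith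
  refine ⟨hw, z, hW.isLeadingEigenvalue_average hw (fun y => (Real.exp_pos _).le) hpos hz, ?_⟩
  have hgμ : Integrable g μ := by
    refine (hintμ.const_mul a⁻¹).mono' (hg.mono_measure hμν) (Eventually.of_forall fun y => ?_)
    exact abs_le_inv_mul_exp ha (g y)
  have hhμ : ∫ y, h y ∂μ = 1 := hℓh
  have hzint : z = ∫ y, Real.exp (θ * g y) * h y ∂μ := by
    rw [← hW.integral_average hμ hw, hz]
    simp [integral_const_mul, hhμ]
  have hwhμ : Integrable (fun y => Real.exp (θ * g y) * h y) μ :=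
    (integrable_weight_mul ℝ hw h).mono_measure hμν
  have hhint := integrable_continuousMap μ h
  -- Uses `z = ∫ exp (θ g) h dμ` and `∫ h dμ = 1`. The first term is a second order Taylor
  -- remainder; the second is a product of two `O(θ)` factors.
  have hsplit : z - (1 + θ * ∫ y, g y ∂μ) =
      ∫ y, ((Real.exp (θ * g y) - 1 - θ * g y) + (Real.exp (θ * g y) - 1) * (h y - 1)) ∂μ := by
    have : ∀ y, (Real.exp (θ * g y) - 1 - θ * g y) + (Real.exp (θ * g y) - 1) * (h y - 1) =
        Real.exp (θ * g y) * h y - h y - θ * g y := fun y => by ring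
    simp_rw [this]
    have h1 := integral_sub (hwhμ.sub hhint) (hgμ.const_mul θ)
    have h2 := integral_sub hwhμ hhint
    simp only [Pi.sub_apply] at h1 h2
    rw [h1, h2, ← hzint, integral_const_mul, hhμ]
    ring
  rw [hsplit, ← Real.norm_eq_abs]
  calc _ ≤ ∫ y, (θ ^ 2 * b ^ 2 + θ * b * (C * (θ * (b * D)))) * Real.exp (a * |g y|) ∂μ := by
        refine norm_integral_le_of_norm_le (hintμ.const_mul _) (Eventually.of_forall fun y => ?_)
        refine (norm_add_le _ _).trans ?_
        rw [norm_mul]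
        have h1 := abs_exp_mul_sub_one_sub_le ha hθ.le hθa (g y)
        have h2 := abs_exp_mul_sub_one_le ha hθ.le hθa (g y)
        have h3 : |h y - 1| ≤ C * (θ * (b * D)) :=
          (hh1 y).trans (hh.trans (by gcongr))
        simp only [Real.norm_eq_abs]
        calc _ ≤ θ ^ 2 * (b ^ 2 * Real.exp (a * |g y|)) +
              θ * (b * Real.exp (a * |g y|)) * (C * (θ * (b * D))) := by gcongr
          _ = _ := by ring
    _ ≤ (θ ^ 2 * b ^ 2 + θ * b * (C * (θ * (b * D)))) * D := by
        rw [integral_const_mul]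
        gcongr
    _ = _ := by ring

end LeadingEigenvalue

/-! ### The noise cube and the law of one random step -/

section Cube

theorem convex_cube (n : ℕ) (σ : ℝ) : Convex ℝ (cube n σ) := by
  intro v hv w hw a b ha hb hab i
  exact convex_Icc (-σ) σ (hv i) (hw i) ha hb hab

theorem volume_cube_ne_zero (n : ℕ) {σ : ℝ} (hσ : 0 < σ) : volume (cube n σ) ≠ 0 := by
  rw [volume_cube]
  exact pow_ne_zero _ (by simpa using hσ)

theorem inv_volume_cube_ne_top (n : ℕ) {σ : ℝ} (hσ : 0 < σ) : (volume (cube n σ))⁻¹ ≠ ⊤ :=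
  ENNReal.inv_ne_top.2 (volume_cube_ne_zero n hσ)

end Cube

namespace NoisyMap
namespace Component

variable {n : ℕ} {S : NoisyMap n} (C : S.Component)

/-- Lebesgue measure on `Y`, divided by the volume of the noise cube. -/
def reference : Measure C.Y :=
  (volume (cube n S.σ))⁻¹ • (volume : Measure (EuclideanSpace ℝ (Fin n))).comap Subtype.val

/-- The points of `Y` which can be reached from `x` in one step. -/
def reachable (x : C.Y) : Set C.Y := {y | (y : EuclideanSpace ℝ (Fin n)) - S.f x ∈ cube n S.σ}

theorem measurableSet_Y : MeasurableSet C.Y := C.isCompact_Y.measurableSet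

theorem reference_apply (A : Set C.Y) :
    C.reference A = (volume (cube n S.σ))⁻¹ * volume (Subtype.val '' A) := by
  rw [reference, Measure.smul_apply, comap_subtype_coe_apply C.measurableSet_Y, smul_eq_mul]

instance : IsFiniteMeasure C.reference := ⟨by
  rw [C.reference_apply, image_univ, Subtype.range_coe]
  exact ENNReal.mul_lt_top (inv_volume_cube_ne_top n S.σ_pos).lt_top
    C.isCompact_Y.measure_lt_top⟩

theorem reference_preimage_eq_zero {N : Set (EuclideanSpace ℝ (Fin n))} (hN : volume N = 0) :
    C.reference (Subtype.val ⁻¹' N) = 0 := by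
  rw [C.reference_apply, measure_mono_null (image_preimage_subset _ _) hN, mul_zero]

theorem reference_preimage_le (N : Set (EuclideanSpace ℝ (Fin n))) :
    C.reference (Subtype.val ⁻¹' N) ≤ (volume (cube n S.σ))⁻¹ * volume N := by
  rw [C.reference_apply]
  gcongr
  exact image_preimage_subset _ _

theorem continuous_f : Continuous fun x : C.Y => S.f x :=
  (S.continuousOn_f.mono C.subset_X).domRestrict

theorem isContinuousDomain : IsContinuousDomain C.reference C.reachable where
  measurableSet x := (measurableSet_cube n S.σ).preimage (by fun_prop)
  eventually_iff x := by
    -- The boundary of the convex cube is null. For `y` off its translate by `f(x)`, membership in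
    -- the reachable set is locally constant in `x`.
    have hnull : volume ((fun y => y - S.f x) ⁻¹' frontier (cube n S.σ)) = 0 := by
      simp_rw [sub_eq_add_neg]
      rw [measure_preimage_add_right]
      exact (convex_cube n S.σ).addHaar_frontier volume
    have h0 := C.reference_preimage_eq_zero hnull
    filter_upwards [measure_eq_zero_iff_ae_notMem.1 h0] with y hy
    have hcont : Tendsto (fun x' : C.Y => (y : EuclideanSpace ℝ (Fin n)) - S.f x') (𝓝 x)
        (𝓝 (y - S.f x)) := (continuous_const.sub C.continuous_f).tendsto x
    have hy' : (y : EuclideanSpace ℝ (Fin n)) - S.f x ∉ frontier (cube n S.σ) := hy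
    by_cases hmem : (y : EuclideanSpace ℝ (Fin n)) - S.f x ∈ cube n S.σ
    · have hint : (y : EuclideanSpace ℝ (Fin n)) - S.f x ∈ interior (cube n S.σ) := by
        by_contra hcon
        exact hy' ⟨subset_closure hmem, hcon⟩
      filter_upwards [hcont.eventually (mem_interior_iff_mem_nhds.1 hint)] with x' hx'
      exact iff_of_true hx' hmem
    · have hcl : (y : EuclideanSpace ℝ (Fin n)) - S.f x ∉ closure (cube n S.σ) := fun hcon =>
        hy' ⟨hcon, fun hi => hmem (interior_subset hi)⟩
      filter_upwards [hcont.eventually (isClosed_closure.isOpen_compl.mem_nhds hcl)] with x' hx'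
      exact iff_of_false (fun h => hx' (subset_closure h)) hmem

theorem measurable_step (x : C.Y) : Measurable fun ω : S.Ω => C.step ω x := by
  refine Measurable.subtype_mk ?_
  exact (measurable_subtype_coe.comp (measurable_pi_apply 0)).const_add _

/-- The law of `f_ω(x)` is the reference measure restricted to the reachable points. -/
theorem map_step (x : C.Y) :
    S.ℙ.map (fun ω => C.step ω x) = C.reference.restrict (C.reachable x) := by
  ext A hA
  rw [Measure.map_apply (C.measurable_step x) hA, Measure.restrict_apply hA,
    C.reference_apply]
  let φ : cube n S.σ → C.Y := fun w => ⟨S.f x + w, C.add_mem x x.2 _ w.2⟩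
  have hφ : Measurable φ := Measurable.subtype_mk (measurable_subtype_coe.const_add _)
  have h1 : S.ℙ ((fun ω => C.step ω x) ⁻¹' A) = noise n S.σ (φ ⁻¹' A) :=
    (measurePreserving_eval_infinitePi (fun _ : ℕ => noise n S.σ) 0).measure_preimage
      (hφ hA).nullMeasurableSet
  -- Translating by `f(x)` turns the reachable points into noise vectors; no mass is lost because
  -- `f(x) + cube` lies in `Y`.
  rw [h1, noise, Measure.smul_apply, comap_subtype_coe_apply (measurableSet_cube n S.σ),
    smul_eq_mul, ← measure_preimage_add volume (S.f x) (Subtype.val '' (A ∩ C.reachable x))]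
  congr 2
  ext w
  constructor
  · rintro ⟨w, hw, rfl⟩
    exact ⟨φ w, ⟨hw, by simp [reachable, φ]⟩, rfl⟩
  · rintro ⟨y, ⟨hyA, hyW⟩, hy⟩
    have hw : w = y - S.f x := by simp [hy]
    refine ⟨⟨w, hw ▸ hyW⟩, ?_, rfl⟩
    have : φ ⟨w, hw ▸ hyW⟩ = y := Subtype.ext hy.symm
    rwa [mem_preimage, this]

instance : IsProbabilityMeasure S.ℙ :=
  inferInstanceAs (IsProbabilityMeasure (Measure.infinitePi fun _ : ℕ => noise n S.σ))

theorem reference_reachable (x : C.Y) : C.reference (C.reachable x) = 1 := by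
  have := congrArg (fun m : Measure C.Y => m univ) (C.map_step x)
  simpa [Measure.map_apply (C.measurable_step x) MeasurableSet.univ] using this.symm

theorem isStationary_iff {μ : Measure C.Y} :
    C.IsStationary μ ↔ μ.bind C.isContinuousDomain.kernel = μ := by
  have hstep : ∀ A, MeasurableSet A → ∀ x,
      S.ℙ {ω | C.step ω x ∈ A} = C.isContinuousDomain.kernel x A := fun A hA x => by
    rw [IsContinuousDomain.kernel_apply, ← C.map_step x, Measure.map_apply (C.measurable_step x) hA]
    rfl
  constructor
  · intro h
    ext A hA
    rw [Measure.bind_apply hA C.isContinuousDomain.kernel.aemeasurable, h A hA]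
    simp_rw [hstep A hA]
  · intro h A hA
    conv_lhs => rw [← h, Measure.bind_apply hA C.isContinuousDomain.kernel.aemeasurable]
    simp_rw [hstep A hA]

theorem isTwistedTransferOperator_average {θ : ℝ}
    (hw : Integrable (fun y : C.Y => Real.exp (θ * S.g y)) C.reference) :
    C.IsTwistedTransferOperator θ (C.isContinuousDomain.average ℂ hw) where
  integrable x := by
    have h1 : Integrable (fun y : C.Y => Real.exp (θ * S.g y))
        (S.ℙ.map fun ω => C.step ω x) := by
      rw [C.map_step]
      exact hw.restrict
    exact h1.comp_measurable (C.measurable_step x)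
  apply_eq h x := by
    have hint := integrable_weight_mul ℂ hw h
    rw [IsContinuousDomain.average_apply, ← C.map_step,
      integral_map (C.measurable_step x).aemeasurable]
    · rfl
    · rw [C.map_step]
      exact hint.restrict.aestronglyMeasurable

end Component
end NoisyMap

/-! ### Volume of neighbourhoods and integrability of the inverse root of the distance -/

section DistanceIntegral

/-- If `ν {d ≤ r} = O(r)`, then `d^{-1/2}` is integrable. -/
theorem lintegral_inv_sqrt_lt_top {Ω : Type*} [MeasurableSpace Ω] {ν : Measure Ω}
    [IsFiniteMeasure ν] {d : Ω → ℝ} (hd : Measurable d) {c : ENNReal} (hc : c ≠ ⊤)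
    (h : ∀ r : ℝ, 0 < r → r ≤ 1 → ν {x | d x ≤ r} ≤ c * ENNReal.ofReal r) :
    ∫⁻ x, ENNReal.ofReal (√(d x))⁻¹ ∂ν < ⊤ := by
  -- Layers `4^{-(k+1)} < d ≤ 4^{-k}`: there `d^{-1/2} ≤ 2 · 2^k`, against measure `O(4^{-k})`,
  -- which leaves a geometric series of ratio `1/2`. For `d ≤ 0` the integrand is `0` by convention.
  have hpt : ∀ x, ENNReal.ofReal (√(d x))⁻¹ ≤ 1 + ∑' k : ℕ,
      {x | d x ≤ (1 / 4) ^ k}.indicator (fun _ => ENNReal.ofReal (2 * 2 ^ k)) x := fun x => by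
    rcases le_or_gt (d x) 0 with h0 | h0
    · simp [Real.sqrt_eq_zero_of_nonpos h0]
    rcases le_or_gt (d x) 1 with h1 | h1
    · obtain ⟨k, hk1, hk2⟩ := exists_nat_pow_near_of_lt_one h0 h1
        (by norm_num : (0 : ℝ) < 1 / 4) (by norm_num)
      refine le_trans ?_ le_add_self
      refine le_trans ?_ (ENNReal.le_tsum k)
      rw [indicator_of_mem (by exact hk2)]
      refine ENNReal.ofReal_le_ofReal ?_
      have h2 : (1 / 2 : ℝ) ^ (k + 1) ≤ √(d x) := by
        refine Real.le_sqrt_of_sq_le (le_trans (le_of_eq ?_) hk1.le)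
        rw [← pow_mul, mul_comm, pow_mul]
        norm_num
      calc (√(d x))⁻¹ ≤ ((1 / 2 : ℝ) ^ (k + 1))⁻¹ := by gcongr
        _ = 2 * 2 ^ k := by rw [← inv_pow, pow_succ]; norm_num; ring
    · refine le_trans ?_ le_self_add
      rw [ENNReal.ofReal_le_one]
      exact inv_le_one_of_one_le₀ (Real.one_le_sqrt.2 h1.le)
  have hmeas : ∀ k : ℕ, MeasurableSet {x | d x ≤ (1 / 4) ^ k} := fun k =>
    measurableSet_le hd measurable_const
  refine (lintegral_mono hpt).trans_lt ?_
  rw [lintegral_add_left measurable_const, lintegral_tsum fun k =>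
    (measurable_const.indicator (hmeas k)).aemeasurable]
  refine ENNReal.add_lt_top.2 ⟨by simp [measure_lt_top], ?_⟩
  have hterm : ∀ k : ℕ, ∫⁻ x, {x | d x ≤ (1 / 4) ^ k}.indicator
      (fun _ => ENNReal.ofReal (2 * 2 ^ k)) x ∂ν ≤ c * ENNReal.ofReal (2 * (1 / 2) ^ k) := fun k => by
    rw [lintegral_indicator_const (hmeas k)]
    calc ENNReal.ofReal (2 * 2 ^ k) * ν {x | d x ≤ (1 / 4) ^ k}
        ≤ ENNReal.ofReal (2 * 2 ^ k) * (c * ENNReal.ofReal ((1 / 4) ^ k)) := by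
          gcongr
          exact h _ (by positivity) (pow_le_one₀ (by norm_num) (by norm_num))
      _ = c * ENNReal.ofReal (2 * (1 / 2) ^ k) := by
          rw [mul_left_comm, ← ENNReal.ofReal_mul (by positivity), mul_assoc, ← mul_pow]
          norm_num
  refine (ENNReal.tsum_le_tsum hterm).trans_lt ?_
  rw [ENNReal.tsum_mul_left, ← ENNReal.ofReal_tsum_of_nonneg (fun k => by positivity)
    (summable_geometric_two.mul_left 2)]
  exact ENNReal.mul_lt_top hc.lt_top ENNReal.ofReal_lt_top

/-- The `r`-neighbourhood of a Lipschitz image of the `m`-cube in dimension `m + 1` has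
volume `O(r)`. -/
theorem exists_volume_neighborhood_le {m n : ℕ} (hmn : n = m + 1)
    {φ : (Fin m → ℝ) → EuclideanSpace ℝ (Fin n)} {L : NNReal}
    (hφ : LipschitzOnWith L φ (Icc 0 1)) :
    ∃ c : ENNReal, c ≠ ⊤ ∧ ∀ r : ℝ, 0 < r → r ≤ 1 →
      volume {y | ∃ t ∈ Icc (0 : Fin m → ℝ) 1, dist y (φ t) < 2 * r} ≤ c * ENNReal.ofReal r := by
  refine ⟨3 ^ m * (ENNReal.ofReal ((L + 2 : ℝ) ^ n) *
    volume (Metric.ball (0 : EuclideanSpace ℝ (Fin n)) 1)), ?_, fun r hr hr1 => ?_⟩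
  · exact ENNReal.mul_ne_top (by simp) (ENNReal.mul_ne_top ENNReal.ofReal_ne_top
      measure_ball_lt_top.ne)
  -- A grid of mesh `1/N ≤ r` has `(N + 1)^m ≤ (3/r)^m` points. The balls of radius `(L + 2) r`
  -- about their images cover the neighbourhood, with total volume `O(r^{n - m}) = O(r)`.
  set N : ℕ := ⌈r⁻¹⌉₊ with hN
  have hN1 : r⁻¹ ≤ N := Nat.le_ceil _
  have hN2 : (N : ℝ) + 1 ≤ 3 * r⁻¹ := by
    have h1 := (Nat.ceil_lt_add_one (inv_nonneg.2 hr.le)).le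
    have h2 : 1 ≤ r⁻¹ := (one_le_inv₀ hr).2 hr1
    linarith
  have hNpos : (0 : ℝ) < N := (inv_pos.2 hr).trans_le hN1
  have hNr : 1 / (N : ℝ) ≤ r := by
    rw [one_div]
    exact inv_le_of_inv_le₀ hr hN1
  let p : (Fin m → Fin (N + 1)) → (Fin m → ℝ) := fun k j => (k j : ℝ) / N
  have hp : ∀ k, p k ∈ Icc (0 : Fin m → ℝ) 1 := fun k =>
    ⟨fun j => by simp only [p, Pi.zero_apply]; positivity, fun j => by
      simp only [p, Pi.one_apply]
      rw [div_le_one hNpos]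
      exact_mod_cast Nat.lt_succ_iff.1 (k j).2⟩
  have hcover : {y | ∃ t ∈ Icc (0 : Fin m → ℝ) 1, dist y (φ t) < 2 * r} ⊆
      ⋃ k, Metric.ball (φ (p k)) ((L + 2) * r) := by
    rintro y ⟨t, ht, hy⟩
    have hk : ∀ j, ⌊N * t j⌋₊ < N + 1 := fun j => by
      rw [Nat.lt_succ_iff]
      refine Nat.floor_le_of_le ?_
      have : t j ≤ 1 := ht.2 j
      nlinarith
    refine mem_iUnion.2 ⟨fun j => ⟨_, hk j⟩, ?_⟩
    rw [Metric.mem_ball]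
    have hdist : dist t (p fun j => ⟨_, hk j⟩) ≤ r := by
      refine (dist_pi_le_iff hr.le).2 fun j => ?_
      have h0 : 0 ≤ t j := ht.1 j
      have h1 := Nat.floor_le (show 0 ≤ (N : ℝ) * t j by positivity)
      have h2 := (Nat.lt_floor_add_one ((N : ℝ) * t j)).le
      have h3 : t j - (⌊N * t j⌋₊ : ℝ) / N = (N * t j - ⌊N * t j⌋₊) / N := by field_simp
      simp only [p]
      rw [Real.dist_eq, h3, abs_of_nonneg (div_nonneg (by linarith) hNpos.le)]
      refine le_trans ?_ hNr
      gcongr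
      linarith
    calc dist y (φ (p fun j => ⟨_, hk j⟩)) ≤ dist y (φ t) + dist (φ t) (φ (p fun j => ⟨_, hk j⟩)) :=
          dist_triangle _ _ _
      _ ≤ dist y (φ t) + L * r := by
          gcongr
          exact (hφ.dist_le_mul _ ht _ (hp _)).trans (by gcongr)
      _ < (L + 2) * r := by linarith
  calc volume {y | ∃ t ∈ Icc (0 : Fin m → ℝ) 1, dist y (φ t) < 2 * r}
      ≤ ∑ k, volume (Metric.ball (φ (p k)) ((L + 2) * r)) :=
        (measure_mono hcover).trans (measure_iUnion_fintype_le _ _)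
    _ = ENNReal.ofReal (((N : ℝ) + 1) ^ m) * (ENNReal.ofReal (((L + 2) * r) ^ n) *
        volume (Metric.ball (0 : EuclideanSpace ℝ (Fin n)) 1)) := by
        have : Nonempty (Fin n) := ⟨⟨0, by omega⟩⟩
        simp_rw [fun k => Measure.addHaar_ball volume (φ (p k))
          (show 0 ≤ ((L : ℝ) + 2) * r by positivity)]
        have h1 : ENNReal.ofReal (((N : ℝ) + 1) ^ m) = ((N + 1) ^ m : ℕ) := by
          rw [← ENNReal.ofReal_natCast]
          push_cast
          rfl
        rw [h1]
        simp [mul_comm]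
    _ ≤ ENNReal.ofReal ((3 * r⁻¹) ^ m) * (ENNReal.ofReal (((L + 2) * r) ^ n) *
        volume (Metric.ball (0 : EuclideanSpace ℝ (Fin n)) 1)) := by gcongr
    _ = _ := by
        have h3 : (3 : ENNReal) ^ m = ENNReal.ofReal (3 ^ m) := by
          rw [ENNReal.ofReal_pow (by norm_num)]; simp
        rw [h3, ← mul_assoc, ← mul_assoc, ← ENNReal.ofReal_mul (by positivity),
          ← ENNReal.ofReal_mul (by positivity), mul_right_comm, ← ENNReal.ofReal_mul (by positivity)]
        congr 2
        subst hmn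
        rw [mul_pow, mul_pow, pow_succ r, inv_pow]
        field_simp

end DistanceIntegral

/-! ### Regularity and exponential moments of `g` -/

namespace NoisyMap

variable {n : ℕ} {S : NoisyMap n}

/-- The critical set lies in a compact set whose `r`-neighbourhoods have volume `O(r)`. -/
theorem NondegenerateCrit.exists_compact (hn : 1 ≤ n) (hcrit : S.NondegenerateCrit) :
    ∃ K : Set (EuclideanSpace ℝ (Fin n)), IsCompact K ∧ S.crit ⊆ K ∧ volume K = 0 ∧
      ∃ c : ENNReal, c ≠ ⊤ ∧ ∀ r : ℝ, 0 < r → r ≤ 1 →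
        volume {y | K.Nonempty ∧ Metric.infDist y K ≤ r} ≤ c * ENNReal.ofReal r := by
  obtain ⟨N, φ, hφ, hsub⟩ := hcrit.exists_param
  have hcompact : IsCompact (Icc (0 : Fin (n - 1) → ℝ) 1) := isCompact_Icc
  have hlip : ∀ i, ∃ L, LipschitzOnWith L (φ i) (Icc 0 1) := fun i =>
    (hφ i).exists_lipschitzOnWith one_ne_zero (convex_Icc 0 1) hcompact
  choose L hL using hlip
  choose c hc hvol using fun i => exists_volume_neighborhood_le (n := n) (by omega) (hL i)
  set K := ⋃ i, φ i '' Icc 0 1 with hK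
  have hctop : ∑ i, c i ≠ ⊤ := ENNReal.sum_ne_top.2 fun i _ => hc i
  have hbound : ∀ r : ℝ, 0 < r → r ≤ 1 →
      volume (⋃ i, {y | ∃ t ∈ Icc (0 : Fin (n - 1) → ℝ) 1, dist y (φ i t) < 2 * r}) ≤
        (∑ i, c i) * ENNReal.ofReal r := fun r hr hr1 => by
    refine (measure_iUnion_fintype_le _ _).trans ?_
    rw [Finset.sum_mul]
    exact Finset.sum_le_sum fun i _ => hvol i r hr hr1
  refine ⟨K, isCompact_iUnion fun i => hcompact.image_of_continuousOn (hφ i).continuousOn, hsub,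
    ?_, ∑ i, c i, hctop, fun r hr hr1 => (measure_mono ?_).trans (hbound r hr hr1)⟩
  -- `K` lies in all its neighbourhoods, whose volumes tend to `0`.
  · have hle : ∀ k : ℕ, volume K ≤ (∑ i, c i) * ENNReal.ofReal ((1 / 2) ^ k) := fun k => by
      refine (measure_mono ?_).trans
        (hbound _ (by positivity) (pow_le_one₀ (by norm_num) (by norm_num)))
      refine iUnion_mono fun i => ?_
      rintro _ ⟨t, ht, rfl⟩
      exact ⟨t, ht, by rw [dist_self]; positivity⟩
    have hlim : Tendsto (fun k : ℕ => (∑ i, c i) * ENNReal.ofReal ((1 / 2) ^ k)) atTop (𝓝 0) := by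
      have := ENNReal.Tendsto.const_mul (a := ∑ i, c i) (ENNReal.tendsto_ofReal
        (tendsto_pow_atTop_nhds_zero_of_lt_one (by norm_num : (0 : ℝ) ≤ 1 / 2) (by norm_num)))
        (Or.inr hctop)
      simpa using this
    exact le_antisymm (ge_of_tendsto' hlim hle) zero_le
  · rintro y ⟨hne, hy⟩
    obtain ⟨z, hz, hyz⟩ := (Metric.infDist_lt_iff hne).1 (hy.trans_lt (by linarith : r < 2 * r))
    obtain ⟨i, t, ht, rfl⟩ := mem_iUnion.1 hz
    exact mem_iUnion.2 ⟨i, t, ht, hyz⟩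

/-- The Hölder bound makes `df` continuous, inversion is continuous at invertible maps, and `‖df⁻¹‖
≠ 0` because `n ≥ 1`. -/
theorem continuousOn_g (hn : 1 ≤ n) (hf : S.IsC1Holder) : ContinuousOn S.g (S.X \ S.crit) := by
  intro x hx
  obtain ⟨α, hα, hloc⟩ := hf
  obtain ⟨K, r, hr, hK⟩ := hloc x hx
  have hdf : ContinuousWithinAt S.df (S.X \ S.crit) x := by
    rw [ContinuousWithinAt, tendsto_iff_norm_sub_tendsto_zero]
    have hlim : Tendsto (fun y => K * dist y x ^ α) (𝓝[S.X \ S.crit] x) (𝓝 0) := by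
      have h1 : Continuous fun y => K * dist y x ^ α :=
        continuous_const.mul ((continuous_id.dist continuous_const).rpow_const fun _ => Or.inr hα.le)
      have h2 := (h1.tendsto x).mono_left (nhdsWithin_le_nhds (s := S.X \ S.crit))
      simpa [Real.zero_rpow hα.ne'] using h2
    refine squeeze_zero' (Eventually.of_forall fun _ => norm_nonneg _) ?_ hlim
    filter_upwards [self_mem_nhdsWithin, nhdsWithin_le_nhds (Metric.ball_mem_nhds x hr)]
      with y hy hyr
    exact hK y hy x hx hyr (by simpa using hr)
  have hinv : (S.df x).IsInvertible := by
    by_contra hcon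
    exact hx.2 ⟨hx.1, fun h => hcon h.2.2⟩
  obtain ⟨e, he⟩ := hinv
  have hcont : ContinuousAt ContinuousLinearMap.inverse (S.df x) := by
    rw [← he]
    exact (contDiffAt_map_inverse (n := 0) e).continuousAt
  have hne : ‖S.dfInv x‖ ≠ 0 := by
    have : Nonempty (Fin n) := ⟨⟨0, hn⟩⟩
    rw [dfInv, ← he, ContinuousLinearMap.inverse_equiv]
    exact e.symm.norm_pos.ne'
  exact (hcont.comp_continuousWithinAt hdf).norm.log hne

/-- Applied at `df⁻¹ u`, the lower bound on `df` gives `‖df⁻¹‖ ≤ q` and the upper bound gives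
`‖df⁻¹‖ ≥ q⁻¹`. -/
theorem abs_g_le_log (hn : 1 ≤ n) {x : EuclideanSpace ℝ (Fin n)} (hx : x ∈ S.X \ S.crit)
    {q : ℝ} (hq : 0 < q)
    (hlow : ∀ v, q⁻¹ * ‖v‖ ≤ ‖S.df x v‖) (hup : ∀ v, ‖S.df x v‖ ≤ q * ‖v‖) :
    |S.g x| ≤ Real.log q := by
  have hinv : (S.df x).IsInvertible := by
    by_contra hcon
    exact hx.2 ⟨hx.1, fun h => hcon h.2.2⟩
  obtain ⟨e, he⟩ := hinv
  have hJ : S.dfInv x = e.symm := by rw [dfInv, ← he, ContinuousLinearMap.inverse_equiv]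
  have hA : ∀ u, S.df x (S.dfInv x u) = u := fun u => by
    rw [hJ, ← he]
    exact e.apply_symm_apply u
  have h1 : ‖S.dfInv x‖ ≤ q := by
    refine ContinuousLinearMap.opNorm_le_bound _ hq.le fun u => ?_
    have := hlow (S.dfInv x u)
    rwa [hA, inv_mul_le_iff₀ hq] at this
  have h2 : q⁻¹ ≤ ‖S.dfInv x‖ := by
    have : Nonempty (Fin n) := ⟨⟨0, hn⟩⟩
    obtain ⟨u, hu⟩ := exists_ne (0 : EuclideanSpace ℝ (Fin n))
    have h3 := hup (S.dfInv x u)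
    rw [hA] at h3
    rw [inv_le_iff_one_le_mul₀' hq]
    have h4 := (S.dfInv x).le_opNorm u
    have hu0 := norm_pos_iff.2 hu
    refine le_of_mul_le_mul_right ?_ hu0
    nlinarith
  have h0 : 0 < ‖S.dfInv x‖ := (inv_pos.2 hq).trans_le h2
  rw [g, abs_le]
  constructor
  · rw [← Real.log_inv]
    exact Real.log_le_log (inv_pos.2 hq) h2
  · exact Real.log_le_log h0 h1

namespace Component

variable (C : S.Component)

theorem ae_notMem_of_volume_eq_zero {K : Set (EuclideanSpace ℝ (Fin n))} (hK : volume K = 0) :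
    ∀ᵐ y : C.Y ∂C.reference, (y : EuclideanSpace ℝ (Fin n)) ∉ K :=
  measure_eq_zero_iff_ae_notMem.1 (C.reference_preimage_eq_zero hK)

theorem aestronglyMeasurable_g (hn : 1 ≤ n) (hf : S.IsC1Holder)
    {K : Set (EuclideanSpace ℝ (Fin n))} (hK : IsClosed K) (hKcrit : S.crit ⊆ K)
    (hK0 : volume K = 0) : AEStronglyMeasurable (fun y : C.Y => S.g y) C.reference := by
  have hms : MeasurableSet {y : C.Y | (y : EuclideanSpace ℝ (Fin n)) ∉ K} :=
    (hK.preimage continuous_subtype_val).measurableSet.compl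
  have hcont : ContinuousOn (fun y : C.Y => S.g y) {y : C.Y | (y : EuclideanSpace ℝ (Fin n)) ∉ K} :=
    (continuousOn_g hn hf).comp continuous_subtype_val.continuousOn
      fun y hy => ⟨C.subset_X y.2, fun h => hy (hKcrit h)⟩
  have := hcont.aestronglyMeasurable (μ := C.reference) hms
  rwa [Measure.restrict_eq_self_of_ae_mem
    (s := {y : C.Y | (y : EuclideanSpace ℝ (Fin n)) ∉ K})
    (C.ae_notMem_of_volume_eq_zero hK0)] at this

/-- `g` has exponential moments with respect to the Lebesgue measure of `Y`. -/
theorem exists_integrable_exp_g (hn : 1 ≤ n) (hf : S.IsC1Holder) (hcrit : S.NondegenerateCrit) :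
    AEStronglyMeasurable (fun y : C.Y => S.g y) C.reference ∧
    ∃ a : ℝ, 0 < a ∧ Integrable (fun y : C.Y => Real.exp (a * |S.g y|)) C.reference := by
  obtain ⟨K, hK, hKcrit, hK0, c, hc, hvol⟩ := hcrit.exists_compact hn
  have hmeas := C.aestronglyMeasurable_g hn hf hK.isClosed hKcrit hK0
  refine ⟨hmeas, ?_⟩
  have hmeas' : ∀ a : ℝ, AEStronglyMeasurable (fun y : C.Y => Real.exp (a * |S.g y|))
      C.reference := fun a => Real.continuous_exp.comp_aestronglyMeasurable (hmeas.norm.const_mul a)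
  -- With no critical points the bounds of (H1) are void, but `g` is continuous on the compact set
  -- `Y`, hence bounded.
  rcases S.crit.eq_empty_or_nonempty with hempty | hne
  · have hcont : ContinuousOn S.g C.Y := (continuousOn_g hn hf).mono (by
      rw [hempty, sdiff_empty]; exact C.subset_X)
    obtain ⟨M, hM⟩ := C.isCompact_Y.exists_bound_of_continuousOn hcont
    refine ⟨1, one_pos, (integrable_const (Real.exp M)).mono' (hmeas' 1)
      (Eventually.of_forall fun y => ?_)⟩
    rw [Real.norm_eq_abs, Real.abs_exp, one_mul]
    exact Real.exp_le_exp.2 (hM y y.2)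
  · obtain ⟨B, β, hB, hβ, hbd, -⟩ := hcrit.exists_bounds
    have hB0 : 0 < B := one_pos.trans hB
    have hKne : K.Nonempty := hne.mono hKcrit
    -- Chosen so that `(B / D^β)^a = B^a D^{-1/2}`. The distance `D` to the critical set is at least
    -- the distance to `K`, for which the volume bound is available.
    set a : ℝ := 1 / (2 * β) with ha
    have ha0 : 0 < a := by positivity
    refine ⟨a, ha0, ?_⟩
    have hd : Measurable fun y : C.Y => Metric.infDist (y : EuclideanSpace ℝ (Fin n)) K :=
      (Metric.continuous_infDist_pt K).measurable.comp measurable_subtype_coe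
    have hfin := lintegral_inv_sqrt_lt_top (ν := C.reference) hd
      (c := (volume (cube n S.σ))⁻¹ * c)
      (ENNReal.mul_ne_top (inv_volume_cube_ne_top n S.σ_pos) hc) fun r hr hr1 => by
        refine (C.reference_preimage_le {y | Metric.infDist y K ≤ r}).trans ?_
        rw [mul_assoc]
        gcongr
        have := hvol r hr hr1
        simpa [hKne] using this
    have hint : Integrable (fun y : C.Y => B ^ a *
        (√(Metric.infDist (y : EuclideanSpace ℝ (Fin n)) K))⁻¹) C.reference := by
      refine Integrable.const_mul ⟨hd.sqrt.inv.aestronglyMeasurable, ?_⟩ _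
      change HasFiniteIntegral (fun y : C.Y =>
        (√(Metric.infDist (y : EuclideanSpace ℝ (Fin n)) K))⁻¹) C.reference
      rwa [hasFiniteIntegral_iff_ofReal
        (Eventually.of_forall fun y => inv_nonneg.2 (Real.sqrt_nonneg _))]
    refine hint.mono' (hmeas' a) ?_
    filter_upwards [C.ae_notMem_of_volume_eq_zero hK0] with y hy
    rw [Real.norm_eq_abs, Real.abs_exp]
    set D := Metric.infDist (y : EuclideanSpace ℝ (Fin n)) S.crit with hD
    have hd0 : 0 < Metric.infDist (y : EuclideanSpace ℝ (Fin n)) K :=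
      (hK.isClosed.notMem_iff_infDist_pos hKne).1 hy
    have hdD : Metric.infDist (y : EuclideanSpace ℝ (Fin n)) K ≤ D :=
      Metric.infDist_le_infDist_of_subset hKcrit hne
    have hD0 : 0 < D := hd0.trans_le hdD
    have hDβ : 0 < D ^ β := Real.rpow_pos_of_pos hD0 β
    have hyX : (y : EuclideanSpace ℝ (Fin n)) ∈ S.X \ S.crit :=
      ⟨C.subset_X y.2, fun h => hy (hKcrit h)⟩
    have hg : |S.g y| ≤ Real.log (B / D ^ β) := by
      refine abs_g_le_log hn hyX (by positivity) (fun v => ?_) fun v => ?_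
      · rw [inv_div, div_eq_mul_one_div, mul_comm (D ^ β)]
        exact (hbd y hyX v).1
      · rw [div_mul_eq_mul_div, le_div_iff₀' hDβ]
        exact (hbd y hyX v).2
    calc Real.exp (a * |S.g y|) ≤ Real.exp (Real.log (B / D ^ β) * a) := by
          rw [mul_comm]; gcongr
      _ = (B / D ^ β) ^ a := (Real.rpow_def_of_pos (by positivity) _).symm
      _ = B ^ a * (√D)⁻¹ := by
          rw [Real.div_rpow hB0.le hDβ.le, ← Real.rpow_mul hD0.le, div_eq_mul_inv,
            show β * a = 1 / 2 by rw [ha]; field_simp, Real.sqrt_eq_rpow]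
      _ ≤ B ^ a * (√(Metric.infDist (y : EuclideanSpace ℝ (Fin n)) K))⁻¹ := by gcongr

end Component
end NoisyMap

/-! ### From a quadratic error to the two expansions -/

theorem isBigO_rpow_of_le_sq {φ : ℝ → ℝ} {C : ℝ}
    (h : ∀ᶠ θ in 𝓝[>] (0 : ℝ), |φ θ| ≤ C * θ ^ 2) :
    φ =O[𝓝[>] 0] (fun θ => θ ^ (4 / 3 : ℝ)) := by
  refine IsBigO.of_bound |C| ?_
  filter_upwards [h, Ioo_mem_nhdsGT (zero_lt_one' ℝ)] with θ hθ hθ1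
  rw [Real.norm_eq_abs, Real.norm_of_nonneg (Real.rpow_nonneg hθ1.1.le _)]
  calc |φ θ| ≤ C * θ ^ 2 := hθ
    _ ≤ |C| * θ ^ 2 := by gcongr; exact le_abs_self C
    _ ≤ |C| * θ ^ (4 / 3 : ℝ) := by
      gcongr
      rw [← Real.rpow_natCast]
      exact Real.rpow_le_rpow_of_exponent_ge hθ1.1 hθ1.2.le (by norm_num)

end RandomHorseshoe

end

theorem proposition3p3 {n : ℕ} (hn : 1 ≤ n) (S : RandomHorseshoe.NoisyMap n)
    (hf : S.IsC1Holder) (hcrit : S.NondegenerateCrit)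
    (C : S.Component) (μ : Measure C.Y) (hμ : C.IsUniquelyErgodic μ)
    (hneg : C.exponent μ < 0) :
    ∃ lam : ℝ → ℝ,
      (∀ᶠ θ in 𝓝[>] (0 : ℝ), ∃ T : C(C.Y, ℂ) →L[ℂ] C(C.Y, ℂ),
        C.IsTwistedTransferOperator θ T ∧ RandomHorseshoe.IsLeadingEigenvalue T (lam θ)) ∧
      (fun θ => lam θ - (1 + θ * C.exponent μ)) =O[𝓝[>] 0] (fun θ => θ ^ (4 / 3 : ℝ)) ∧
      (fun θ => lam θ - Real.exp (θ * C.exponent μ)) =O[𝓝[>] 0]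
        (fun θ => θ ^ (4 / 3 : ℝ)) := by
  have : Nonempty C.Y := C.nonempty_Y.to_subtype
  have := hμ.isProbabilityMeasure
  obtain ⟨hg, a, ha, hint⟩ := C.exists_integrable_exp_g hn hf hcrit
  obtain ⟨K, θ₀, hθ₀, h⟩ := C.isContinuousDomain.exists_leadingEigenvalue C.reference_reachable
    (C.isStationary_iff.1 hμ.isStationary)
    (fun m hm hmb => hμ.unique m hm (C.isStationary_iff.2 hmb)) hg ha hint
  have hev : ∀ᶠ θ in 𝓝[>] (0 : ℝ), ∃ r : ℝ, (∃ T : C(C.Y, ℂ) →L[ℂ] C(C.Y, ℂ),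
      C.IsTwistedTransferOperator θ T ∧ RandomHorseshoe.IsLeadingEigenvalue T r) ∧
        |r - (1 + θ * C.exponent μ)| ≤ K * θ ^ 2 := by
    filter_upwards [Ioo_mem_nhdsGT hθ₀] with θ hθ
    obtain ⟨hw, r, hr, hbound⟩ := h θ hθ.1 hθ.2
    exact ⟨r, ⟨_, C.isTwistedTransferOperator_average hw, hr⟩, hbound⟩
  obtain ⟨lam, hlam⟩ := hev.choice
  have hfirst := hlam.mono fun θ hθ => hθ.2
  refine ⟨lam, hlam.mono fun θ hθ => hθ.1, RandomHorseshoe.isBigO_rpow_of_le_sq hfirst,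
    RandomHorseshoe.isBigO_rpow_of_le_sq
      (C := K + C.exponent μ ^ 2 * Real.exp |C.exponent μ|) ?_⟩
  filter_upwards [hfirst, Ioo_mem_nhdsGT (zero_lt_one' ℝ)] with θ hθ hθ1
  -- The two first order approximations differ by a Taylor remainder, `O(θ²)` for `θ < 1`.
  have hexp := RandomHorseshoe.abs_exp_sub_one_sub_le_mul_exp (θ * C.exponent μ)
  have hle : Real.exp |θ * C.exponent μ| ≤ Real.exp |C.exponent μ| := by
    rw [Real.exp_le_exp, abs_mul, abs_of_pos hθ1.1]
    exact mul_le_of_le_one_left (abs_nonneg _) hθ1.2.le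
  rw [sq_abs, mul_pow] at hexp
  calc |lam θ - Real.exp (θ * C.exponent μ)|
      = |(lam θ - (1 + θ * C.exponent μ)) -
          (Real.exp (θ * C.exponent μ) - 1 - θ * C.exponent μ)| := by ring_nf
    _ ≤ K * θ ^ 2 + θ ^ 2 * C.exponent μ ^ 2 * Real.exp |C.exponent μ| :=
        (abs_sub _ _).trans (add_le_add hθ (hexp.trans (by gcongr)))
    _ = _ := by ring
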